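/- Let $\mathcal E$ be an elementary topos (finite limits and colimits, cartesian closed, with a subobject classifier). Let $\mathbb I$ be an interval object in $\mathcal E$: an object with endpoints $\partial_0,\partial_1:1\to\mathbb I$ such that $[\partial_0,\partial_1]:1+1\to\mathbb I$ is monic, and with connections $\wedge,\vee:\mathbb I\times\mathbb I\to\mathbb I$ satisfying $i\wedge 0=0\wedge i=0$, $i\wedge 1=1\wedge i=i$, $i\vee 0=0\vee i=i$, $i\vee 1=1\vee i=1$. Let $\mathcal C$ be a class of monomorphisms (the cofibrations) which is a dominance (it contains all isomorphisms, is closed under composition and pullback, and the category of members of $\mathcal C$ and pullback squares between them has a terminal object), is closed under finite unions of subobjects (in particular every $0\to X$ is in $\mathcal C$), and contains $[\partial_0,\partial_1]$. A map is a trivial fibration if it has the right lifting property against every cofibration, and a fibration if it has the right lifting property against the pushout products $\partial_i\hat\otimes u$ for all $u\in\mathcal C$, $i\in\{0,1\}$; an object $X$ is fibrant if $X\to 1$ is a fibration. Maps $f,g:B\to A$ are homotopic if $f=H(\partial_0\times B)$ and $g=H(\partial_1\times B)$ for some $H:\mathbb I\times B\to A$; homotopy equivalences are the maps invertible up to homotopy.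 (1) For every fibration $f:B\to A$, the right adjoint $\Pi_f:\mathcal E/B\to\mathcal E/A$ of the pullback functor $f^*$ preserves trivial fibrations: if $k$ is a map of $\mathcal E/B$ whose underlying map in $\mathcal E$ is a trivial fibration, then so is the underlying map of $\Pi_f(k)$. (2) Consequently, the model of type theory in which types in context $B$ ($B$ fibrant) are fibrations over $B$ satisfies function extensionality. Explicitly: call an identity type of $X\to B$ a factorisation $X\xrightarrow{r}P\xrightarrow{(s,t)}X\times_BX$ of the diagonal into a cofibration $r$ that is a homotopy equivalence, followed by a fibration. Let $A$ be fibrant, $f:B\to A$ and $X\to B$ fibrations, $(P,r,s,t)$ an identity type of $X$ over $B$, and $(Q,r',s',t')$ an identity type of $\Pi_fX$ over $A$. Then there is a map $h:Q\to\Pi_fP$ over $A$ with $\Pi_f(s)\,h=s'$, $\Pi_f(t)\,h=t'$ and $h\,r'=\Pi_f(r)$ (it sends an identification of functions to a pointwise identification), and every such $h$ is a homotopy equivalence. -/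

import Mathlib

open CategoryTheory CategoryTheory.Limits MonoidalCategory CartesianMonoidalCategory

universe v u

namespace ToposFunext

set_option linter.unusedSectionVars false

section DependentProducts

/-- A square with monic top edge is a pullback as soon as it has the right generalised elements. -/
theorem isPullback_of_elements {E : Type u} [Category.{v} E] {S X C K : E}
    {m : S ⟶ X} {s : S ⟶ C} {k : X ⟶ K} {e : C ⟶ K} [Mono m] (w : m ≫ k = s ≫ e)
    (H : ∀ (T : E) (x : T ⟶ X) (c : T ⟶ C), x ≫ k = c ≫ e → ∃ t : T ⟶ S, t ≫ m = x ∧ t ≫ s = c) :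
    IsPullback m s k e :=
  ⟨⟨w⟩, ⟨PullbackCone.isLimitAux' _ fun c => by
    have h := H c.pt c.fst c.snd c.condition
    refine ⟨h.choose, h.choose_spec.1, h.choose_spec.2, fun {l} h₁ _ => ?_⟩
    exact (cancel_mono m).1 (h₁.trans h.choose_spec.1.symm)⟩⟩

variable {E : Type u} [Category.{v} E] [HasFiniteLimits E] [CartesianMonoidalCategory E]
  [MonoidalClosed E] [HasSubobjectClassifier E]

open HasSubobjectClassifier in
theorem factors_iff_true {U X T : E} (m : U ⟶ X) [Mono m] (x : T ⟶ X) :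
    (∃ t, t ≫ m = x) ↔ x ≫ χ m = Subobject.Classifier.χ₀ _ T ≫ truth E := by
  constructor
  · rintro ⟨t, rfl⟩
    rw [Category.assoc, comm m, ← Category.assoc]
    congr 1
    exact Subsingleton.elim _ _
  · intro h
    exact ⟨(isPullback_χ m).lift x _ h, (isPullback_χ m).lift_fst _ _ _⟩

open HasSubobjectClassifier in
/-- Two characteristic maps agree if they have the same true generalised elements. -/
theorem eq_χ_of_elements {U X : E} (m : U ⟶ X) [Mono m] (k : X ⟶ Ω E)
    (H : ∀ (T : E) (x : T ⟶ X),
      x ≫ k = Subobject.Classifier.χ₀ _ T ≫ truth E ↔ ∃ t, t ≫ m = x) : k = χ m := by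
  refine HasSubobjectClassifier.unique m k (isPullback_of_elements ?_ ?_)
  · exact (H U m).2 ⟨𝟙 _, Category.id_comp _⟩
  · intro T x c h
    have hc : c = Subobject.Classifier.χ₀ _ T := Subsingleton.elim _ _
    subst hc
    obtain ⟨t, ht⟩ := (H T x).1 h
    exact ⟨t, ht, Subsingleton.elim _ _⟩

open HasSubobjectClassifier MonoidalClosed in
/-- Every object has a partial map classifier. -/
theorem exists_partialMapClassifier (C : E) :
    ∃ (K : E) (η : C ⟶ K), Mono η ∧ ∀ {S X : E} (m : S ⟶ X) [Mono m] (s : S ⟶ C),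
      ∃ k : X ⟶ K, IsPullback m s k η ∧ ∀ k' : X ⟶ K, IsPullback m s k' η → k' = k := by
  -- the diagonal and the singleton map
  let Δ : C ⟶ C ⊗ C := lift (𝟙 C) (𝟙 C)
  have : Mono Δ := mono_of_mono_fac (lift_fst (𝟙 C) (𝟙 C))
  let σ : C ⟶ (ihom C).obj (Ω E) := curry (χ Δ)
  have hfac : ∀ {T : E} (x y : T ⟶ C), (∃ t, t ≫ Δ = lift x y) ↔ x = y := by
    intro T x y
    constructor
    · rintro ⟨t, ht⟩
      have h1 := congrArg (· ≫ fst _ _) ht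
      have h2 := congrArg (· ≫ snd _ _) ht
      simp [Δ] at h1 h2
      exact h1.symm.trans h2
    · rintro rfl
      exact ⟨x, by simp [Δ]⟩
  -- evaluating a family of subobjects at an element
  have ev : ∀ {T X : E} (φ : C ⊗ X ⟶ Ω E) (c : T ⟶ C) (x : T ⟶ X),
      lift c (𝟙 T) ≫ uncurry (x ≫ curry φ) = lift c x ≫ φ := by
    intro T X φ c x
    rw [uncurry_natural_left, uncurry_curry, ← Category.assoc]
    simp
  have ext : ∀ {X : E} (a b : X ⟶ (ihom C).obj (Ω E)), (∀ (T : E) (c : T ⟶ C) (x : T ⟶ X),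
      lift c x ≫ uncurry a = Subobject.Classifier.χ₀ _ T ≫ truth E ↔
      lift c x ≫ uncurry b = Subobject.Classifier.χ₀ _ T ≫ truth E) → a = b := by
    intro X a b h
    apply uncurry_injective
    obtain ⟨Z, i, _, hi⟩ := Subobject.Classifier.surjective_χ
      (HasSubobjectClassifier.exists_classifier.some) (uncurry b)
    change uncurry b = χ i at hi
    rw [hi]
    apply eq_χ_of_elements
    intro T x
    rw [factors_iff_true, ← hi]
    have := h T (x ≫ fst _ _) (x ≫ snd _ _)
    simpa using this
  have hσ : ∀ {T : E} (x : T ⟶ C) {T' : E} (c : T' ⟶ C) (t : T' ⟶ T),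
      lift c t ≫ uncurry (x ≫ σ) = Subobject.Classifier.χ₀ _ T' ≫ truth E ↔ c = t ≫ x := by
    intro T x T' c t
    rw [uncurry_natural_left, uncurry_curry, ← Category.assoc, ← hfac, factors_iff_true]
    simp
  have monoσ : Mono σ := by
    constructor
    intro T x y h
    have h1 := (hσ x x (𝟙 T)).2 (by simp)
    rw [h] at h1
    simpa using (hσ y x (𝟙 T)).1 h1
  let g : C ⟶ C ⊗ (ihom C).obj (Ω E) := lift (𝟙 C) σ
  have : Mono g := mono_of_mono_fac (lift_fst (𝟙 C) σ)
  have hg : ∀ {T : E} (c : T ⟶ C) (p : T ⟶ (ihom C).obj (Ω E)),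
      lift c p ≫ χ g = Subobject.Classifier.χ₀ _ T ≫ truth E ↔ p = c ≫ σ := by
    intro T c p
    rw [← factors_iff_true]
    constructor
    · rintro ⟨t, ht⟩
      have h1 := congrArg (· ≫ fst _ _) ht
      have h2 := congrArg (· ≫ snd _ _) ht
      simp [g] at h1 h2
      rw [← h1, h2]
    · rintro rfl
      exact ⟨c, by simp [g]⟩
  let e : (ihom C).obj (Ω E) ⟶ (ihom C).obj (Ω E) := curry (χ g)
  have he : ∀ {X : E} (p : X ⟶ (ihom C).obj (Ω E)) {T : E} (c : T ⟶ C) (x : T ⟶ X),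
      lift c x ≫ uncurry (p ≫ e) = Subobject.Classifier.χ₀ _ T ≫ truth E ↔ x ≫ p = c ≫ σ := by
    intro X p T c x
    rw [uncurry_natural_left, uncurry_curry, ← Category.assoc, ← hg]
    simp
  have hσe : σ ≫ e = σ ≫ 𝟙 _ := by
    rw [Category.comp_id]
    apply ext
    intro T c x
    rw [he]
    have := hσ (𝟙 C) c x
    rw [Category.id_comp, Category.comp_id] at this
    rw [this, cancel_mono]
    exact eq_comm
  let η : C ⟶ equalizer e (𝟙 _) := equalizer.lift σ hσe
  have hη : η ≫ equalizer.ι e (𝟙 _) = σ := equalizer.lift_ι _ _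
  have : Mono η := mono_of_mono_fac hη
  refine ⟨equalizer e (𝟙 _), η, inferInstance, ?_⟩
  intro S X m _ s
  have : Mono (lift s m) := mono_of_mono_fac (lift_snd s m)
  let φ : X ⟶ (ihom C).obj (Ω E) := curry (χ (lift s m))
  have hφ : ∀ {T : E} (c : T ⟶ C) (x : T ⟶ X),
      lift c x ≫ uncurry φ = Subobject.Classifier.χ₀ _ T ≫ truth E ↔
        ∃ t : T ⟶ S, t ≫ m = x ∧ t ≫ s = c := by
    intro T c x
    rw [uncurry_curry, ← factors_iff_true]
    constructor
    · rintro ⟨t, ht⟩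
      have h1 := congrArg (· ≫ fst _ _) ht
      have h2 := congrArg (· ≫ snd _ _) ht
      simp at h1 h2
      exact ⟨t, h2, h1⟩
    · rintro ⟨t, rfl, rfl⟩
      exact ⟨t, by simp⟩
  have hmφ : m ≫ φ = s ≫ σ := by
    apply ext
    intro T c t
    rw [hσ, uncurry_natural_left, ← Category.assoc, lift_whiskerLeft, hφ]
    constructor
    · rintro ⟨t', h1, h2⟩
      rw [cancel_mono] at h1
      rw [← h2, h1]
    · rintro rfl
      exact ⟨t, rfl, rfl⟩
  have hφσ : ∀ {T : E} (c : T ⟶ C) (x : T ⟶ X),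
      x ≫ φ = c ≫ σ ↔ ∃ t : T ⟶ S, t ≫ m = x ∧ t ≫ s = c := by
    intro T c x
    constructor
    · intro h
      rw [← hφ]
      have h1 := (hσ c c (𝟙 T)).2 (by simp)
      rw [← h, uncurry_natural_left, ← Category.assoc, lift_whiskerLeft] at h1
      simpa using h1
    · rintro ⟨t, rfl, rfl⟩
      rw [Category.assoc, hmφ, Category.assoc]
  have hφe : φ ≫ e = φ ≫ 𝟙 _ := by
    rw [Category.comp_id]
    apply ext
    intro T c x
    rw [he, hφσ, hφ]
  refine ⟨equalizer.lift φ hφe, isPullback_of_elements ?_ ?_, ?_⟩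
  · apply (cancel_mono (equalizer.ι e (𝟙 _))).1
    simp [hη, hmφ]
  · intro T x c h
    have h1 := congrArg (· ≫ equalizer.ι e (𝟙 _)) h
    simp [hη] at h1
    exact (hφσ c x).1 h1
  · intro k hk
    apply (cancel_mono (equalizer.ι e (𝟙 _))).1
    rw [equalizer.lift_ι]
    apply ext
    intro T c x
    have h0 : (k ≫ equalizer.ι e (𝟙 _)) ≫ e = k ≫ equalizer.ι e (𝟙 _) := by
      rw [Category.assoc, equalizer.condition, Category.comp_id]
    rw [← h0, he, hφ, ← hη, ← Category.assoc, ← Category.assoc, cancel_mono]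
    constructor
    · intro h
      exact ⟨hk.lift x c h, hk.lift_fst _ _ _, hk.lift_snd _ _ _⟩
    · rintro ⟨t, rfl, rfl⟩
      rw [Category.assoc, hk.w, Category.assoc]

open MonoidalClosed in
/-- An elementary topos is locally cartesian closed: pullback along any map has a right adjoint. -/
theorem pullback_isLeftAdjoint {A B : E} (f : B ⟶ A) : (Over.pullback f).IsLeftAdjoint := by
  rw [isLeftAdjoint_iff_hasTerminal_costructuredArrow]
  intro g
  obtain ⟨KC, ηC, hηC, hC⟩ := exists_partialMapClassifier g.left
  obtain ⟨KB, ηB, hηB, hB⟩ := exists_partialMapClassifier B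
  obtain ⟨gt, hgt, -⟩ := hB ηC g.hom
  have : Mono (lift (𝟙 B) f) := mono_of_mono_fac (lift_fst (𝟙 B) f)
  obtain ⟨r, hr, -⟩ := hB (lift (𝟙 B) f) (𝟙 B)
  let p : pullback ((ihom B).map gt) (curry r) ⟶ A := pullback.snd _ _
  -- the graph of the second projection of a pullback along `f`
  have hd : ∀ {T : E} (t : T ⟶ A), IsPullback (lift (pullback.snd t f) (pullback.fst t f))
      (pullback.snd t f) (B ◁ t ≫ r) ηB := by
    intro T t
    have : Mono (lift (pullback.snd t f) (pullback.fst t f)) := by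
      constructor
      intro Z a b h
      have h1 := congrArg (· ≫ fst _ _) h
      have h2 := congrArg (· ≫ snd _ _) h
      simp at h1 h2
      exact pullback.hom_ext h2 h1
    have h1 : IsPullback (lift (pullback.snd t f) (pullback.fst t f)) (pullback.snd t f) (B ◁ t)
        (lift (𝟙 B) f) := by
      apply isPullback_of_elements
      · rw [lift_whiskerLeft, pullback.condition]
        simp
      · intro Z x c h
        have h1 := congrArg (· ≫ fst _ _) h
        have h2 := congrArg (· ≫ snd _ _) h
        simp at h1 h2
        refine ⟨pullback.lift (x ≫ snd _ _) c (by simpa using h2), ?_, ?_⟩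
        · apply CartesianMonoidalCategory.hom_ext
          · simp [pullback.lift_snd, h1]
          · simp [pullback.lift_fst]
        · exact pullback.lift_snd _ _ _
    simpa using h1.paste_vert hr
  have hdm : ∀ {T : E} (t : T ⟶ A), Mono (lift (pullback.snd t f) (pullback.fst t f)) := by
    intro T t
    constructor
    intro Z a b h
    have h1 := congrArg (· ≫ fst _ _) h
    have h2 := congrArg (· ≫ snd _ _) h
    simp at h1 h2
    exact pullback.hom_ext h2 h1
  -- the bijection between sections and partial maps
  have key : ∀ {T : E} (t : T ⟶ A) (s : pullback t f ⟶ g.left), s ≫ g.hom = pullback.snd t f →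
      ∃ φ : B ⊗ T ⟶ KC, (φ ≫ gt = B ◁ t ≫ r ∧
        s ≫ ηC = lift (pullback.snd t f) (pullback.fst t f) ≫ φ) ∧
        ∀ φ' : B ⊗ T ⟶ KC, φ' ≫ gt = B ◁ t ≫ r →
          s ≫ ηC = lift (pullback.snd t f) (pullback.fst t f) ≫ φ' → φ' = φ := by
    intro T t s hs
    have := hdm t
    obtain ⟨φ, hφ, hφu⟩ := hC (lift (pullback.snd t f) (pullback.fst t f)) s
    obtain ⟨ψ, hψ, hψu⟩ := hB (lift (pullback.snd t f) (pullback.fst t f)) (pullback.snd t f)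
    refine ⟨φ, ⟨?_, hφ.w.symm⟩, ?_⟩
    · rw [hψu (B ◁ t ≫ r) (hd t)]
      apply hψu
      simpa [hs] using hφ.paste_vert hgt
    · intro φ' h1 h2
      apply hφu
      refine IsPullback.of_bot ?_ h2.symm hgt
      rw [hs, h1]
      exact hd t
  have hev : uncurry (pullback.fst ((ihom B).map gt) (curry r)) ≫ gt = B ◁ p ≫ r := by
    rw [← uncurry_natural_right, pullback.condition, uncurry_natural_left, uncurry_curry]
  have hε : ∃ ε : pullback p f ⟶ g.left, ε ≫ ηC =
      lift (pullback.snd p f) (pullback.fst p f) ≫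
        uncurry (pullback.fst ((ihom B).map gt) (curry r)) ∧ ε ≫ g.hom = pullback.snd p f := by
    have w : (lift (pullback.snd p f) (pullback.fst p f) ≫
        uncurry (pullback.fst ((ihom B).map gt) (curry r))) ≫ gt = pullback.snd p f ≫ ηB := by
      rw [Category.assoc, hev, (hd p).w]
    exact ⟨hgt.lift _ _ w, hgt.lift_fst _ _ _, hgt.lift_snd _ _ _⟩
  obtain ⟨ε, hε1, hε2⟩ := hε
  let P : Over A := Over.mk p
  let εo : (Over.pullback f).obj P ⟶ g := Over.homMk ε hε2
  have univ : ∀ (T : Over A) (k : (Over.pullback f).obj T ⟶ g),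
      ∃ l : T ⟶ P, (Over.pullback f).map l ≫ εo = k ∧
        ∀ l' : T ⟶ P, (Over.pullback f).map l' ≫ εo = k → l' = l := by
    intro T k
    have hk : k.left ≫ g.hom = pullback.snd T.hom f := Over.w k
    obtain ⟨φ, ⟨hφ1, hφ2⟩, hφu⟩ := key T.hom k.left hk
    have w : curry φ ≫ (ihom B).map gt = T.hom ≫ curry r := by
      rw [← curry_natural_right, hφ1, curry_natural_left]
    let l : T ⟶ P := Over.homMk (pullback.lift (curry φ) T.hom w) (pullback.lift_snd _ _ _)
    have hcomp : ∀ l' : T ⟶ P, ((Over.pullback f).map l' ≫ εo).left ≫ ηC =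
        lift (pullback.snd T.hom f) (pullback.fst T.hom f) ≫
          uncurry (l'.left ≫ pullback.fst ((ihom B).map gt) (curry r)) := by
      intro l'
      obtain ⟨b, hb, hb1, hb2⟩ : ∃ b : pullback T.hom f ⟶ pullback p f,
          ((Over.pullback f).map l' ≫ εo).left = b ≫ ε ∧
          b ≫ pullback.fst p f = pullback.fst _ _ ≫ l'.left ∧
          b ≫ pullback.snd p f = pullback.snd _ _ :=
        ⟨((Over.pullback f).map l').left, rfl, pullback.lift_fst _ _ _, pullback.lift_snd _ _ _⟩
      rw [hb, Category.assoc, hε1, uncurry_natural_left, ← Category.assoc, ← Category.assoc,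
        lift_whiskerLeft, comp_lift, hb1, hb2]
    refine ⟨l, ?_, ?_⟩
    · ext
      apply (cancel_mono ηC).1
      have hl : l.left ≫ pullback.fst ((ihom B).map gt) (curry r) = curry φ :=
        pullback.lift_fst _ _ _
      rw [hcomp, hφ2, hl, uncurry_curry]
    · intro l' hl'
      ext
      have h2 : l'.left ≫ p = T.hom := Over.w l'
      apply pullback.hom_ext
      · rw [← uncurry_injective.eq_iff]
        have h1 : uncurry (l'.left ≫ pullback.fst ((ihom B).map gt) (curry r)) = φ := by
          apply hφu
          · rw [uncurry_natural_left, Category.assoc, hev, ← Category.assoc,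
              ← MonoidalCategory.whiskerLeft_comp, h2]
          · rw [← hcomp, hl']
        have hl : l.left ≫ pullback.fst ((ihom B).map gt) (curry r) = curry φ :=
          pullback.lift_fst _ _ _
        rw [h1, hl, uncurry_curry]
      · exact h2.trans (pullback.lift_snd _ _ _).symm
  refine IsTerminal.hasTerminal (X := CostructuredArrow.mk (Y := P) εo) ?_
  exact IsTerminal.ofUniqueHom
    (fun Y => CostructuredArrow.homMk (univ Y.left Y.hom).choose
      (univ Y.left Y.hom).choose_spec.1)
    (fun Y m => by
      apply CostructuredArrow.hom_ext
      exact (univ Y.left Y.hom).choose_spec.2 m.left (CostructuredArrow.w m))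

/-- The dependent product functor `Π_f : E/B ⥤ E/A`, the right adjoint to pullback along
`f : B ⟶ A`. -/
noncomputable def depProd {A B : E} (f : B ⟶ A) : Over B ⥤ Over A :=
  letI := pullback_isLeftAdjoint f
  Functor.rightAdjoint (Over.pullback f)

/-- The adjunction `f^* ⊣ Π_f`. -/
noncomputable def depProdAdj {A B : E} (f : B ⟶ A) : Over.pullback f ⊣ depProd f :=
  letI := pullback_isLeftAdjoint f
  Adjunction.ofIsLeftAdjoint (Over.pullback f)

end DependentProducts

section Setting

variable {E : Type u} [Category.{v} E]

/-- A class of monomorphisms is a dominance if it contains the isomorphisms, is closed under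
composition and pullback, and the category of its members and pullback squares has a terminal
object. -/
structure IsDominance (S : MorphismProperty E) : Prop where
  mono : ∀ {X Y : E} (m : X ⟶ Y), S m → Mono m
  iso : ∀ {X Y : E} (m : X ⟶ Y), IsIso m → S m
  comp : ∀ {X Y Z : E} (m : X ⟶ Y) (n : Y ⟶ Z), S m → S n → S (m ≫ n)
  pullback : ∀ {U V X Y : E} (m' : U ⟶ X) (q : U ⟶ V) (p : X ⟶ Y) (m : V ⟶ Y),
    IsPullback m' q p m → S m → S m'
  terminal : ∃ (T₀ T : E) (t : T₀ ⟶ T), S t ∧ ∀ {U X : E} (m : U ⟶ X), S m →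
    ∃! p : (U ⟶ T₀) × (X ⟶ T), IsPullback m p.1 p.2 t

variable (E) in
/-- An interval object: two disjoint endpoints and two connections. -/
structure IntervalObject [CartesianMonoidalCategory E] [HasFiniteColimits E] where
  /-- the underlying object -/
  obj : E
  /-- the endpoint `0` -/
  zero : 𝟙_ E ⟶ obj
  /-- the endpoint `1` -/
  one : 𝟙_ E ⟶ obj
  mono_endpoints : Mono (coprod.desc zero one)
  /-- the connection `∧` -/
  meet : obj ⊗ obj ⟶ obj
  /-- the connection `∨` -/
  join : obj ⊗ obj ⟶ obj
  meet_zero : lift (𝟙 obj) (toUnit obj ≫ zero) ≫ meet = toUnit obj ≫ zero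
  zero_meet : lift (toUnit obj ≫ zero) (𝟙 obj) ≫ meet = toUnit obj ≫ zero
  meet_one : lift (𝟙 obj) (toUnit obj ≫ one) ≫ meet = 𝟙 obj
  one_meet : lift (toUnit obj ≫ one) (𝟙 obj) ≫ meet = 𝟙 obj
  join_zero : lift (𝟙 obj) (toUnit obj ≫ zero) ≫ join = 𝟙 obj
  zero_join : lift (toUnit obj ≫ zero) (𝟙 obj) ≫ join = 𝟙 obj
  join_one : lift (𝟙 obj) (toUnit obj ≫ one) ≫ join = toUnit obj ≫ one
  one_join : lift (toUnit obj ≫ one) (𝟙 obj) ≫ join = toUnit obj ≫ one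

variable [CartesianMonoidalCategory E] [HasFiniteColimits E]

/-- A class of cofibrations: a dominance closed under finite unions (of subobjects), which contains
the inclusion of the endpoints of the interval. -/
structure IsCofibrationClass (I : IntervalObject E) (C : MorphismProperty E) : Prop where
  dominance : IsDominance C
  bot : ∀ X : E, C (initial.to X)
  union : ∀ {U V W X : E} (m : U ⟶ X) (n : V ⟶ X) (w : W ⟶ X) [Mono m] [Mono n] [Mono w],
    C m → C n → IsLUB {Subobject.mk m, Subobject.mk n} (Subobject.mk w) → C w
  endpoints : C (coprod.desc I.zero I.one)

/-- The Leibniz product (pushout product) of two maps. -/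
noncomputable abbrev leibnizProd {X Y Z W : E} (f : X ⟶ Y) (g : Z ⟶ W) :
    pushout (f ▷ Z) (X ◁ g) ⟶ Y ⊗ W :=
  pushout.desc (Y ◁ g) (f ▷ W) (whisker_exchange f g).symm

/-- Trivial fibrations: the maps with the right lifting property against all cofibrations. -/
def IsTrivialFibration (C : MorphismProperty E) {X Y : E} (p : X ⟶ Y) : Prop :=
  ∀ {U V : E} (u : U ⟶ V), C u → HasLiftingProperty u p

/-- Fibrations: the maps with the right lifting property against the Leibniz products of an
endpoint of the interval and a cofibration. -/
def IsFibration (I : IntervalObject E) (C : MorphismProperty E) {X Y : E} (p : X ⟶ Y) : Prop :=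
  ∀ {U V : E} (u : U ⟶ V), C u →
    HasLiftingProperty (leibnizProd I.zero u) p ∧ HasLiftingProperty (leibnizProd I.one u) p

/-- Fibrant objects. -/
def IsFibrantObject (I : IntervalObject E) (C : MorphismProperty E) (X : E) : Prop :=
  IsFibration I C (toUnit X)

/-- The homotopy relation on parallel maps. -/
def Homotopic (I : IntervalObject E) {B A : E} (f g : B ⟶ A) : Prop :=
  ∃ H : I.obj ⊗ B ⟶ A,
    lift (toUnit B ≫ I.zero) (𝟙 B) ≫ H = f ∧ lift (toUnit B ≫ I.one) (𝟙 B) ≫ H = g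

/-- Homotopy equivalences. -/
def IsHomotopyEquivalence (I : IntervalObject E) {B A : E} (f : B ⟶ A) : Prop :=
  ∃ g : A ⟶ B, Homotopic I (f ≫ g) (𝟙 B) ∧ Homotopic I (g ≫ f) (𝟙 A)

/-- An identity type of a type `X` in context `B`: a factorisation of the diagonal
`X ⟶ X ×_B X` as a cofibration which is a homotopy equivalence, followed by a fibration. -/
structure IdentityType [HasFiniteLimits E] (I : IntervalObject E) (C : MorphismProperty E) {B : E}
    (X : Over B) where
  /-- the object of paths -/
  path : Over B
  /-- reflexivity -/
  refl : X ⟶ path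
  /-- the start of a path -/
  src : path ⟶ X
  /-- the end of a path -/
  tgt : path ⟶ X
  refl_src : refl ≫ src = 𝟙 X
  refl_tgt : refl ≫ tgt = 𝟙 X
  cofibration : C refl.left
  homotopyEquivalence : IsHomotopyEquivalence I refl.left
  fibration : IsFibration I C
    (pullback.lift src.left tgt.left ((Over.w src).trans (Over.w tgt).symm) :
      path.left ⟶ pullback X.hom X.hom)

variable [HasFiniteLimits E] [MonoidalClosed E] [HasSubobjectClassifier E]

/-- Let `X` be a type over `B`, let `f : B ⟶ A`, and let `P` and `Q` be identity types of `X` and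
of `Π_f X`. A map `h : Q.path ⟶ Π_f P.path` over `A` is a comparison map, sending an identification
of two functions to a pointwise identification between them, if it preserves the endpoints and
sends the reflexivity path at a function to the pointwise reflexivity path. -/
structure IsHapply {I : IntervalObject E} {C : MorphismProperty E} {A B : E} (f : B ⟶ A)
    {X : Over B} (P : IdentityType I C X) (Q : IdentityType I C ((depProd f).obj X))
    (h : Q.path ⟶ (depProd f).obj P.path) : Prop where
  src : h ≫ (depProd f).map P.src = Q.src
  tgt : h ≫ (depProd f).map P.tgt = Q.tgt
  refl : Q.refl ≫ h = (depProd f).map P.refl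

/-- Function extensionality for the types given by fibrations over fibrant objects: for every
dependent product type, the comparison map from identifications of functions to pointwise
identifications exists and is an equivalence. -/
def FunctionExtensionality (I : IntervalObject E) (C : MorphismProperty E) : Prop :=
  ∀ {A B : E} (f : B ⟶ A), IsFibrantObject I C A → IsFibration I C f →
    ∀ X : Over B, IsFibration I C X.hom →
      ∀ (P : IdentityType I C X) (Q : IdentityType I C ((depProd f).obj X)),
        (∃ h, IsHapply f P Q h) ∧ ∀ h, IsHapply f P Q h → IsHomotopyEquivalence I h.left

end Setting

end ToposFunext

open ToposFunext

/-! Cofibrations are stable under pullback, so `f^*` preserves them, and transposing lifting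
problems across `f^* ⊣ Π_f` shows that `Π_f` preserves trivial fibrations.

For function extensionality, the source map `s` of an identity type is a fibration with section `r`,
and `r` is a homotopy equivalence, so `s` is one too. Between fibrant objects such a map is a
trivial fibration (`IsFibration.isTrivialFibration`), hence `Π_f(s)` is a trivial fibration and so a
homotopy equivalence. Since `s'` is also a homotopy equivalence and `Π_f(s) h = s'`, cancellation
gives the same for `h`.

The map `h` itself is a diagonal filler of `r'` against `Π_f(s, t)`. It exists because a cofibration
between fibrant objects that is a homotopy equivalence lifts against all fibrations
(`IsFibration.hasLiftingProperty`), and because `Π_f` preserves fibrations when `f` is one. The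
latter is the Frobenius property: pullbacks of `∂_i ⊗̂ u` along fibrations still lift against
fibrations, which the connections make possible by contracting the cylinder to an endpoint.

The homotopy theory rests on filling open boxes, and this needs the boundary inclusion `(1 + 1) × V
∪ I × U → I × V` to be a cofibration. Here the topos structure enters: the pushout of two subobjects
along their intersection is their union. -/

namespace ToposFunext

/-! ### Pullback squares, and colimits in a topos -/

section Topos

set_option linter.unusedSectionVars false

variable {E : Type u} [Category.{v} E] [HasFiniteLimits E] [CartesianMonoidalCategory E]

/-- A commutative square is a pullback if it has the right generalised elements. -/
theorem isPullback_of_existsUnique {P X Y Z : E} {a : P ⟶ X} {b : P ⟶ Y} {f : X ⟶ Z} {g : Y ⟶ Z}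
    (w : a ≫ f = b ≫ g) (H : ∀ {T : E} (x : T ⟶ X) (y : T ⟶ Y), x ≫ f = y ≫ g →
      ∃ t : T ⟶ P, t ≫ a = x ∧ t ≫ b = y ∧ ∀ l : T ⟶ P, l ≫ a = x → l ≫ b = y → l = t) :
    IsPullback a b f g :=
  ⟨⟨w⟩, ⟨PullbackCone.isLimitAux' _ fun c => by
    have h := H c.fst c.snd c.condition
    exact ⟨h.choose, h.choose_spec.1, h.choose_spec.2.1, fun {l} => h.choose_spec.2.2 l⟩⟩⟩

/-- The square of a pushout product in a category with finite products is a pullback. -/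
theorem isPullback_whisker {X Y Z W : E} (f : X ⟶ Y) (g : Z ⟶ W) :
    IsPullback (X ◁ g) (f ▷ Z) (f ▷ W) (Y ◁ g) := by
  refine isPullback_of_existsUnique (whisker_exchange f g) fun {T} x y h => ?_
  have h1 := congrArg (· ≫ fst _ _) h
  have h2 := congrArg (· ≫ snd _ _) h
  simp at h1 h2
  refine ⟨lift (x ≫ fst _ _) (y ≫ snd _ _), ?_, ?_, ?_⟩
  · apply CartesianMonoidalCategory.hom_ext <;> simp [h2]
  · apply CartesianMonoidalCategory.hom_ext <;> simp [h1]
  · rintro l rfl rfl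
    apply CartesianMonoidalCategory.hom_ext <;> simp

theorem isPullback_whiskerLeft_snd (X : E) {Z W : E} (g : Z ⟶ W) :
    IsPullback (X ◁ g) (snd X Z) (snd X W) g := by
  refine isPullback_of_existsUnique (by simp) fun {T} x y h => ?_
  refine ⟨lift (x ≫ fst _ _) y, ?_, by simp, ?_⟩
  · apply CartesianMonoidalCategory.hom_ext <;> simp [h]
  · rintro l rfl rfl
    apply CartesianMonoidalCategory.hom_ext <;> simp

theorem isPullback_whiskerRight_fst {X Y : E} (f : X ⟶ Y) (Z : E) :
    IsPullback (f ▷ Z) (fst X Z) (fst Y Z) f := by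
  refine isPullback_of_existsUnique (by simp) fun {T} x y h => ?_
  refine ⟨lift y (x ≫ snd _ _), ?_, by simp, ?_⟩
  · apply CartesianMonoidalCategory.hom_ext <;> simp [h]
  · rintro l rfl rfl
    apply CartesianMonoidalCategory.hom_ext <;> simp

/-- By the pasting law. Hence `f^*` carries a cofibration in the slice to a base change of it, which
is again a cofibration. -/
theorem isPullback_overPullback {A B : E} (f : B ⟶ A) {S T : Over A} (j : S ⟶ T) :
    IsPullback ((Over.pullback f).map j).left (pullback.fst S.hom f) (pullback.fst T.hom f)
      j.left := by
  have h : ((Over.pullback f).map j).left ≫ pullback.snd T.hom f = pullback.snd S.hom f :=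
    pullback.lift_snd _ _ _
  have h' : j.left ≫ T.hom = S.hom := Over.w j
  refine (IsPullback.of_bot (v₂₁ := pullback.snd T.hom f) (v₂₂ := T.hom) (h₃₁ := f) ?_ ?_
    (IsPullback.of_hasPullback T.hom f)).flip
  · rw [h']
    erw [h]
    exact IsPullback.of_hasPullback S.hom f
  · exact (pullback.lift_fst _ _ _).symm

section Closed

variable [MonoidalClosed E]

/-- In a cartesian closed category the initial object is strict, so `T` is itself initial. -/
theorem hom_ext_of_initial [HasInitial E] {X T : E} (t : T ⟶ ⊥_ E) (a b : T ⟶ X) : a = b := by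
  have := strict_initial initialIsInitial t
  rw [← cancel_epi (inv t)]
  exact initialIsInitial.hom_ext _ _

open MonoidalClosed

/-- `F ⊗ -` is a left adjoint, so it preserves pushouts; currying reduces to the universal property
without the factor `F`. -/
theorem tensor_pushout_desc [HasFiniteColimits E] (F : E) {S U V Z : E} (a : S ⟶ U) (b : S ⟶ V)
    (α : F ⊗ U ⟶ Z) (β : F ⊗ V ⟶ Z) (w : F ◁ a ≫ α = F ◁ b ≫ β) :
    ∃ γ : F ⊗ pushout a b ⟶ Z, F ◁ pushout.inl a b ≫ γ = α ∧ F ◁ pushout.inr a b ≫ γ = β := by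
  have w' : a ≫ curry α = b ≫ curry β := by
    rw [← curry_natural_left, ← curry_natural_left, w]
  refine ⟨uncurry (pushout.desc (curry α) (curry β) w'), ?_, ?_⟩
  · rw [← uncurry_natural_left, pushout.inl_desc, uncurry_curry]
  · rw [← uncurry_natural_left, pushout.inr_desc, uncurry_curry]

theorem tensor_pushout_hom_ext [HasFiniteColimits E] (F : E) {S U V Z : E} (a : S ⟶ U)
    (b : S ⟶ V) {γ δ : F ⊗ pushout a b ⟶ Z}
    (h₁ : F ◁ pushout.inl a b ≫ γ = F ◁ pushout.inl a b ≫ δ)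
    (h₂ : F ◁ pushout.inr a b ≫ γ = F ◁ pushout.inr a b ≫ δ) : γ = δ := by
  apply curry_injective
  apply pushout.hom_ext
  · rw [← curry_natural_left, h₁, curry_natural_left]
  · rw [← curry_natural_left, h₂, curry_natural_left]

theorem tensor_coprod_desc [HasFiniteColimits E] (F : E) {U V Z : E}
    (α : F ⊗ U ⟶ Z) (β : F ⊗ V ⟶ Z) :
    ∃ γ : F ⊗ (U ⨿ V) ⟶ Z, F ◁ coprod.inl ≫ γ = α ∧ F ◁ coprod.inr ≫ γ = β := by
  refine ⟨uncurry (coprod.desc (curry α) (curry β)), ?_, ?_⟩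
  · rw [← uncurry_natural_left, coprod.inl_desc, uncurry_curry]
  · rw [← uncurry_natural_left, coprod.inr_desc, uncurry_curry]

theorem tensor_coprod_hom_ext [HasFiniteColimits E] (F : E) {U V Z : E}
    {γ δ : F ⊗ (U ⨿ V) ⟶ Z} (h₁ : F ◁ coprod.inl ≫ γ = F ◁ coprod.inl ≫ δ)
    (h₂ : F ◁ coprod.inr ≫ γ = F ◁ coprod.inr ≫ δ) : γ = δ := by
  apply curry_injective
  apply coprod.hom_ext
  · rw [← curry_natural_left, h₁, curry_natural_left]
  · rw [← curry_natural_left, h₂, curry_natural_left]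

/-- Maps out of `F ⊗ ((1 + 1) ⊗ V)` are pairs of maps out of `F ⊗ V`. -/
theorem endpoints_desc [HasFiniteColimits E] (F V : E) {Z : E} (α β : F ⊗ V ⟶ Z) :
    ∃ γ : F ⊗ ((𝟙_ E ⨿ 𝟙_ E) ⊗ V) ⟶ Z,
      F ◁ lift (toUnit V ≫ coprod.inl) (𝟙 V) ≫ γ = α ∧
      F ◁ lift (toUnit V ≫ coprod.inr) (𝟙 V) ≫ γ = β := by
  obtain ⟨γ, h₁, h₂⟩ := tensor_coprod_desc (F ⊗ V) (fst _ (𝟙_ E) ≫ α) (fst _ (𝟙_ E) ≫ β)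
  refine ⟨lift (lift (fst _ _) (snd _ _ ≫ snd _ _)) (snd _ _ ≫ fst _ _) ≫ γ, ?_, ?_⟩
  · have h := congrArg (fun k => lift (𝟙 (F ⊗ V)) (toUnit _) ≫ k) h₁
    simp only [← Category.assoc, lift_fst, Category.id_comp, lift_whiskerLeft] at h
    rw [← h, ← Category.assoc]
    congr 1
    apply CartesianMonoidalCategory.hom_ext
    · apply CartesianMonoidalCategory.hom_ext <;> simp
    · simp [← Category.assoc]
  · have h := congrArg (fun k => lift (𝟙 (F ⊗ V)) (toUnit _) ≫ k) h₂
    simp only [← Category.assoc, lift_fst, Category.id_comp, lift_whiskerLeft] at h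
    rw [← h, ← Category.assoc]
    congr 1
    apply CartesianMonoidalCategory.hom_ext
    · apply CartesianMonoidalCategory.hom_ext <;> simp
    · simp [← Category.assoc]

theorem endpoints_hom_ext [HasFiniteColimits E] (F V : E) {Z : E}
    {γ δ : F ⊗ ((𝟙_ E ⨿ 𝟙_ E) ⊗ V) ⟶ Z}
    (h₁ : F ◁ lift (toUnit V ≫ coprod.inl) (𝟙 V) ≫ γ = F ◁ lift (toUnit V ≫ coprod.inl) (𝟙 V) ≫ δ)
    (h₂ : F ◁ lift (toUnit V ≫ coprod.inr) (𝟙 V) ≫ γ =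
      F ◁ lift (toUnit V ≫ coprod.inr) (𝟙 V) ≫ δ) : γ = δ := by
  let e : (F ⊗ V) ⊗ (𝟙_ E ⨿ 𝟙_ E) ⟶ F ⊗ ((𝟙_ E ⨿ 𝟙_ E) ⊗ V) :=
    lift (fst _ _ ≫ fst _ _) (lift (snd _ _) (fst _ _ ≫ snd _ _))
  let e' : F ⊗ ((𝟙_ E ⨿ 𝟙_ E) ⊗ V) ⟶ (F ⊗ V) ⊗ (𝟙_ E ⨿ 𝟙_ E) :=
    lift (lift (fst _ _) (snd _ _ ≫ snd _ _)) (snd _ _ ≫ fst _ _)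
  have he : e' ≫ e = 𝟙 _ := by
    apply CartesianMonoidalCategory.hom_ext
    · simp [e, e']
    · apply CartesianMonoidalCategory.hom_ext <;> simp [e, e']
  have key : ∀ i : 𝟙_ E ⟶ 𝟙_ E ⨿ 𝟙_ E,
      (F ⊗ V) ◁ i ≫ e = fst _ _ ≫ F ◁ lift (toUnit V ≫ i) (𝟙 V) := by
    intro i
    apply CartesianMonoidalCategory.hom_ext
    · simp [e]
    · apply CartesianMonoidalCategory.hom_ext
      · simp only [e, Category.assoc, lift_snd, whiskerLeft_snd, lift_fst]
        simp only [← Category.assoc]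
        congr 1
        exact Subsingleton.elim _ _
      · simp [e]
  -- The permutation `e` of the factors is split epic, so it may be precomposed to bring `1 + 1`
  -- into the last position.
  suffices h : e ≫ γ = e ≫ δ by
    rw [← Category.id_comp γ, ← Category.id_comp δ, ← he, Category.assoc, h, Category.assoc]
  apply tensor_coprod_hom_ext
  · rw [← Category.assoc, key, Category.assoc, h₁, ← Category.assoc, ← key, Category.assoc]
  · rw [← Category.assoc, key, Category.assoc, h₂, ← Category.assoc, ← key, Category.assoc]

variable [HasSubobjectClassifier E]

/-- Jointly epic pairs of maps are stable under pullback. -/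
theorem hom_ext_of_jointly_epi {U V P : E} {i : U ⟶ P} {j : V ⟶ P}
    (H : ∀ {Z : E} (a b : P ⟶ Z), i ≫ a = i ≫ b → j ≫ a = j ≫ b → a = b) {T Z : E} (x : T ⟶ P)
    {a b : T ⟶ Z} (hi : ∀ {T' : E} (t : T' ⟶ T) (s : T' ⟶ U), s ≫ i = t ≫ x → t ≫ a = t ≫ b)
    (hj : ∀ {T' : E} (t : T' ⟶ T) (s : T' ⟶ V), s ≫ j = t ≫ x → t ≫ a = t ≫ b) : a = b := by
  let adj := depProdAdj x
  -- A map `c` is encoded by its graph `x^*(1_P) ≅ T → Z × T` over `T`. Its transpose along `x^* ⊣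
  -- Π_x` is a map out of `P`, and there equality may be tested on `U` and `V`.
  let α : ∀ c : T ⟶ Z, (Over.pullback x).obj (Over.mk (𝟙 P)) ⟶ Over.mk (snd Z T) := fun c =>
    Over.homMk (pullback.snd (𝟙 P) x ≫ lift c (𝟙 T)) (by simp)
  have key : ∀ {W : E} (k : W ⟶ P), pullback.snd k x ≫ a = pullback.snd k x ≫ b →
      k ≫ (adj.homEquiv _ _ (α a)).left = k ≫ (adj.homEquiv _ _ (α b)).left := by
    intro W k hk
    let κ : Over.mk k ⟶ Over.mk (𝟙 P) := Over.homMk k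
    suffices h : κ ≫ adj.homEquiv _ _ (α a) = κ ≫ adj.homEquiv _ _ (α b) from
      congrArg CommaMorphism.left h
    rw [← adj.homEquiv_naturality_left, ← adj.homEquiv_naturality_left]
    congr 1
    ext
    have h : ((Over.pullback x).map κ).left ≫ pullback.snd (𝟙 P) x = pullback.snd k x :=
      pullback.lift_snd _ _ _
    change ((Over.pullback x).map κ).left ≫ pullback.snd (𝟙 P) x ≫ _ =
      ((Over.pullback x).map κ).left ≫ pullback.snd (𝟙 P) x ≫ _
    rw [← Category.assoc, h, ← Category.assoc, h, comp_lift, comp_lift, hk]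
  have h : α a = α b := by
    apply (adj.homEquiv _ _).injective
    ext
    exact H _ _ (key i (hi _ _ pullback.condition)) (key j (hj _ _ pullback.condition))
  have h' : pullback.snd (𝟙 P) x ≫ lift a (𝟙 T) = pullback.snd (𝟙 P) x ≫ lift b (𝟙 T) :=
    congrArg CommaMorphism.left h
  have h'' := congrArg (fun k => pullback.lift x (𝟙 T) (by simp) ≫ k ≫ fst _ _) h'
  simpa [← Category.assoc, pullback.lift_snd] using h''

variable [HasFiniteColimits E]

/-- The pushout of two subobjects along their intersection is a subobject. -/
theorem mono_pushout_desc {W U V X : E} {a : W ⟶ U} {b : W ⟶ V} {m : U ⟶ X} {n : V ⟶ X}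
    [Mono m] [Mono n] (h : IsPullback a b m n) : Mono (pushout.desc m n h.w) := by
  constructor
  intro T x y hxy
  have H : ∀ {Z : E} (c d : pushout a b ⟶ Z), pushout.inl a b ≫ c = pushout.inl a b ≫ d →
      pushout.inr a b ≫ c = pushout.inr a b ≫ d → c = d := fun _ _ => pushout.hom_ext
  have hm : ∀ {T' : E} (t : T' ⟶ T), t ≫ x ≫ pushout.desc m n h.w =
      t ≫ y ≫ pushout.desc m n h.w := fun t => by rw [hxy]
  -- Both `x` and `y` may be assumed to factor locally through `U` or `V`, giving four cases. If
  -- they land in the same piece, that piece is monic in `X`; if in different pieces, the two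
  -- elements come from one element of `W`, which the pushout identifies.
  refine hom_ext_of_jointly_epi H x (fun t s hs => ?_) (fun t s hs => ?_) <;>
  refine hom_ext_of_jointly_epi H (t ≫ y) (fun t' s' hs' => ?_) (fun t' s' hs' => ?_) <;>
  (have e := hm (t' ≫ t)
   simp only [Category.assoc] at hs' e
   have e1 := congrArg (fun k => t' ≫ k ≫ pushout.desc m n h.w) hs
   have e2 := congrArg (fun k => k ≫ pushout.desc m n h.w) hs'
   simp only [Category.assoc, pushout.inl_desc, pushout.inr_desc] at e1 e2
   rw [← hs, ← hs', ← Category.assoc]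
   rw [← e1, ← e2, ← Category.assoc] at e)
  · rw [(cancel_mono m).1 e]
  · rw [← h.lift_fst _ _ e, Category.assoc, pushout.condition, ← Category.assoc, h.lift_snd]
  · rw [← h.lift_fst _ _ e.symm, Category.assoc _ a, pushout.condition, ← Category.assoc,
      h.lift_snd]
  · rw [(cancel_mono n).1 e]

theorem isLUB_pushout_desc {W U V X : E} {a : W ⟶ U} {b : W ⟶ V} {m : U ⟶ X} {n : V ⟶ X}
    [Mono m] [Mono n] (w : a ≫ m = b ≫ n) [Mono (pushout.desc m n w)] :
    IsLUB {Subobject.mk m, Subobject.mk n} (Subobject.mk (pushout.desc m n w)) := by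
  constructor
  · rintro _ (rfl | rfl)
    · exact Subobject.mk_le_mk_of_comm (pushout.inl a b) (pushout.inl_desc _ _ _)
    · exact Subobject.mk_le_mk_of_comm (pushout.inr a b) (pushout.inr_desc _ _ _)
  · intro s hs
    have h₁ : Subobject.mk m ≤ s := hs (by simp)
    have h₂ : Subobject.mk n ≤ s := hs (by simp)
    refine Subobject.mk_le_of_comm (pushout.desc (Subobject.ofMkLE m s h₁)
      (Subobject.ofMkLE n s h₂) ?_) ?_
    · rw [← cancel_mono s.arrow]
      simp [w]
    · apply pushout.hom_ext <;> simp [pushout.inl_desc_assoc, pushout.inr_desc_assoc,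
        pushout.inl_desc, pushout.inr_desc]

end Closed

end Topos

/-! ### Cofibrations, pushout products and cylinders -/

section Cofibrations

set_option linter.unusedSectionVars false

variable {E : Type u} [Category.{v} E] [CartesianMonoidalCategory E] [HasFiniteColimits E]

theorem coprod_desc_swap {X Y : E} (a b : X ⟶ Y) :
    coprod.desc b a = (coprod.braiding _ _).hom ≫ coprod.desc a b := by
  apply coprod.hom_ext
  · rw [coprod.inl_desc, coprod.braiding_hom, coprod.inl_desc_assoc, coprod.inr_desc]
  · rw [coprod.inr_desc, coprod.braiding_hom, coprod.inr_desc_assoc, coprod.inl_desc]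

namespace IntervalObject

/-- The interval with its endpoints exchanged. -/
def swap (I : IntervalObject E) : IntervalObject E where
  obj := I.obj
  zero := I.one
  one := I.zero
  mono_endpoints := by
    have := I.mono_endpoints
    rw [coprod_desc_swap]
    infer_instance
  meet := I.join
  join := I.meet
  meet_zero := I.join_one
  zero_meet := I.one_join
  meet_one := I.join_zero
  one_meet := I.zero_join
  join_zero := I.meet_one
  zero_join := I.one_meet
  join_one := I.meet_zero
  one_join := I.zero_meet

/-- The inclusion of `V` at the endpoint `0` of the cylinder on `V`. -/
abbrev in₀ (I : IntervalObject E) (V : E) : V ⟶ I.obj ⊗ V := lift (toUnit V ≫ I.zero) (𝟙 V)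

/-- The inclusion of `V` at the endpoint `1` of the cylinder on `V`. -/
abbrev in₁ (I : IntervalObject E) (V : E) : V ⟶ I.obj ⊗ V := lift (toUnit V ≫ I.one) (𝟙 V)

variable (I : IntervalObject E)

theorem in₀_naturality {U V : E} (f : U ⟶ V) : I.in₀ U ≫ I.obj ◁ f = f ≫ I.in₀ V := by
  simp [← Category.assoc]

theorem in₀_naturality_assoc {U V Z : E} (f : U ⟶ V) (h : I.obj ⊗ V ⟶ Z) :
    I.in₀ U ≫ I.obj ◁ f ≫ h = f ≫ I.in₀ V ≫ h := by
  rw [← Category.assoc, I.in₀_naturality, Category.assoc]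

theorem in₁_naturality {U V : E} (f : U ⟶ V) : I.in₁ U ≫ I.obj ◁ f = f ≫ I.in₁ V := by
  simp [← Category.assoc]

theorem in₁_naturality_assoc {U V Z : E} (f : U ⟶ V) (h : I.obj ⊗ V ⟶ Z) :
    I.in₁ U ≫ I.obj ◁ f ≫ h = f ≫ I.in₁ V ≫ h := by
  rw [← Category.assoc, I.in₁_naturality, Category.assoc]

end IntervalObject

variable {I : IntervalObject E} {C : MorphismProperty E}

/-- Lets every result about the endpoint `0` be reused for the endpoint `1`. -/
theorem IsCofibrationClass.swap (hC : IsCofibrationClass I C) : IsCofibrationClass I.swap C where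
  dominance := hC.dominance
  bot := hC.bot
  union := hC.union
  endpoints := by
    change C (coprod.desc I.one I.zero)
    rw [coprod_desc_swap]
    exact hC.dominance.comp _ _ (hC.dominance.iso _ inferInstance) hC.endpoints

theorem IsFibration.swap {X Y : E} {p : X ⟶ Y} (hp : IsFibration I C p) :
    IsFibration I.swap C p := fun u hu => (hp u hu).symm

variable [HasFiniteLimits E] [MonoidalClosed E] [HasSubobjectClassifier E]

/-- Let `p, q : 1 → T` classify the cofibrations `1 → 1` and `0 → 1` in the dominance. Then the
first injection is the pullback of the generic cofibration `t` along `[p, q]`. Composed with `[∂₀,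
∂₁]` it shows that a single endpoint is a cofibration. -/
theorem IsCofibrationClass.inl_unit (hC : IsCofibrationClass I C) :
    C (coprod.inl : 𝟙_ E ⟶ 𝟙_ E ⨿ 𝟙_ E) := by
  obtain ⟨T₀, T, t, hCt, ht⟩ := hC.dominance.terminal
  obtain ⟨⟨p₀, p⟩, hp, -⟩ := ht _ (hC.dominance.iso (𝟙 (𝟙_ E)) inferInstance)
  obtain ⟨⟨q₀, q⟩, hq, -⟩ := ht _ (hC.bot (𝟙_ E))
  dsimp only at hp hq
  have : Mono (coprod.inl : 𝟙_ E ⟶ 𝟙_ E ⨿ 𝟙_ E) := ⟨fun _ _ _ => toUnit_unique _ _⟩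
  refine hC.dominance.pullback _ p₀ (coprod.desc p q) t ?_ hCt
  refine isPullback_of_elements ?_ ?_
  · rw [coprod.inl_desc, ← hp.w, Category.id_comp]
  · intro T' x c h
    have hx : x = toUnit _ ≫ coprod.inl := by
      refine hom_ext_of_jointly_epi (i := coprod.inl) (j := coprod.inr)
        (fun _ _ => coprod.hom_ext) x (fun s k hk => ?_) (fun s k hk => ?_)
      · rw [← hk, ← Category.assoc]
        congr 1
        exact toUnit_unique _ _
      -- Over the second summand, `q` factors through `t`, so this part of `T'` maps to `0` and is
      -- empty.
      · have e : k ≫ q = (s ≫ c) ≫ t := by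
          rw [Category.assoc, ← h, ← Category.assoc, ← hk, Category.assoc, coprod.inr_desc]
        exact hom_ext_of_initial (hq.lift _ _ e) _ _
    refine ⟨toUnit _, hx.symm, ?_⟩
    have := hC.dominance.mono t hCt
    rw [← cancel_mono t, ← h, hx, Category.assoc, Category.assoc, coprod.inl_desc, ← hp.w,
      Category.id_comp]

theorem IsCofibrationClass.zero (hC : IsCofibrationClass I C) : C I.zero := by
  have := hC.dominance.comp _ _ hC.inl_unit hC.endpoints
  rwa [coprod.inl_desc] at this

/-- The Leibniz product of two cofibrations is a cofibration. -/
theorem IsCofibrationClass.leibnizProd (hC : IsCofibrationClass I C) {X Y Z W : E} {f : X ⟶ Y}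
    {g : Z ⟶ W} (hf : C f) (hg : C g) : C (leibnizProd f g) := by
  have h₁ : C (Y ◁ g) := hC.dominance.pullback _ _ _ _ (isPullback_whiskerLeft_snd Y g) hg
  have h₂ : C (f ▷ W) := hC.dominance.pullback _ _ _ _ (isPullback_whiskerRight_fst f W) hf
  have := hC.dominance.mono _ h₁
  have := hC.dominance.mono _ h₂
  -- The subobjects `Y × Z` and `X × W` of `Y × W` meet in `X × Z`, so their union is the pushout.
  have h := (isPullback_whisker f g).flip
  have := mono_pushout_desc h
  exact hC.union _ _ _ h₁ h₂ (isLUB_pushout_desc h.w)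

/-- Lifting against `∂₀ ⊗̂ u` as a homotopy lifting property: the homotopy `K` lifts to `X`, with
the lift prescribed over `U` and at time `0`. The proof only removes the unit factor in `1 ⊗ V`. -/
theorem IsFibration.fill₀ {X Y : E} {p : X ⟶ Y} (hp : IsFibration I C p) {U V : E} {u : U ⟶ V}
    (hu : C u) (L : I.obj ⊗ U ⟶ X) (l : V ⟶ X) (K : I.obj ⊗ V ⟶ Y)
    (h₁ : I.in₀ U ≫ L = u ≫ l) (h₂ : L ≫ p = I.obj ◁ u ≫ K) (h₃ : l ≫ p = I.in₀ V ≫ K) :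
    ∃ M : I.obj ⊗ V ⟶ X, M ≫ p = K ∧ I.obj ◁ u ≫ M = L ∧ I.in₀ V ≫ M = l := by
  have := (hp u hu).1
  have hV : ∀ V : E, I.zero ▷ V = snd _ _ ≫ I.in₀ V := by
    intro V
    apply CartesianMonoidalCategory.hom_ext
    · rw [whiskerRight_fst, Category.assoc, lift_fst, ← Category.assoc]
      congr 1
      exact toUnit_unique _ _
    · simp
  have hV' : ∀ V : E, I.in₀ V = lift (toUnit _) (𝟙 V) ≫ I.zero ▷ V := by
    intro V
    apply CartesianMonoidalCategory.hom_ext <;> simp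
  have w : I.zero ▷ U ≫ L = 𝟙_ E ◁ u ≫ snd _ _ ≫ l := by
    rw [hV, Category.assoc, h₁, ← Category.assoc, ← Category.assoc, whiskerLeft_snd]
  have sq : CommSq (pushout.desc L (snd _ _ ≫ l) w) (ToposFunext.leibnizProd I.zero u) p K := by
    constructor
    apply pushout.hom_ext
    · rw [pushout.inl_desc_assoc, pushout.inl_desc_assoc, h₂]
    · rw [pushout.inr_desc_assoc, pushout.inr_desc_assoc, Category.assoc, h₃, hV, Category.assoc]
  refine ⟨sq.lift, sq.fac_right, ?_, ?_⟩
  · have := congrArg (pushout.inl _ _ ≫ ·) sq.fac_left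
    simpa only [pushout.inl_desc_assoc, pushout.inl_desc] using this
  · have := congrArg (pushout.inr _ _ ≫ ·) sq.fac_left
    simp only [pushout.inr_desc_assoc, pushout.inr_desc] at this
    rw [hV', Category.assoc, this]
    simp

theorem IsFibration.fill₁ {X Y : E} {p : X ⟶ Y} (hp : IsFibration I C p) {U V : E} {u : U ⟶ V}
    (hu : C u) (L : I.obj ⊗ U ⟶ X) (l : V ⟶ X) (K : I.obj ⊗ V ⟶ Y)
    (h₁ : I.in₁ U ≫ L = u ≫ l) (h₂ : L ≫ p = I.obj ◁ u ≫ K) (h₃ : l ≫ p = I.in₁ V ≫ K) :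
    ∃ M : I.obj ⊗ V ⟶ X, M ≫ p = K ∧ I.obj ◁ u ≫ M = L ∧ I.in₁ V ≫ M = l :=
  IsFibration.fill₀ (I := I.swap) hp.swap hu L l K h₁ h₂ h₃

/-- The inclusion of the boundary of the cylinder on `V`, together with the cylinder on `U`. -/
noncomputable abbrev cylBoundary (I : IntervalObject E) {U V : E} (u : U ⟶ V) :=
  leibnizProd (coprod.desc I.zero I.one) u

theorem in₀_eq (V : E) : I.in₀ V =
    lift (toUnit V ≫ coprod.inl) (𝟙 V) ≫ coprod.desc I.zero I.one ▷ V := by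
  rw [lift_whiskerRight, Category.assoc, coprod.inl_desc]

theorem in₁_eq (V : E) : I.in₁ V =
    lift (toUnit V ≫ coprod.inr) (𝟙 V) ≫ coprod.desc I.zero I.one ▷ V := by
  rw [lift_whiskerRight, Category.assoc, coprod.inr_desc]

/-- Gluing maps out of the boundary of a cylinder (times `F`). -/
theorem exists_boundary_desc (I : IntervalObject E) (F : E) {U V Z : E} (u : U ⟶ V)
    (L₀ L₁ : F ⊗ V ⟶ Z) (M : F ⊗ (I.obj ⊗ U) ⟶ Z)
    (h₀ : F ◁ I.in₀ U ≫ M = F ◁ u ≫ L₀) (h₁ : F ◁ I.in₁ U ≫ M = F ◁ u ≫ L₁) :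
    ∃ (γ : F ⊗ pushout (coprod.desc I.zero I.one ▷ U) ((𝟙_ E ⨿ 𝟙_ E) ◁ u) ⟶ Z),
      F ◁ pushout.inl _ _ ≫ γ = M ∧
      F ◁ lift (toUnit V ≫ coprod.inl) (𝟙 V) ≫ F ◁ pushout.inr _ _ ≫ γ = L₀ ∧
      F ◁ lift (toUnit V ≫ coprod.inr) (𝟙 V) ≫ F ◁ pushout.inr _ _ ≫ γ = L₁ := by
  obtain ⟨δ, hδ₀, hδ₁⟩ := endpoints_desc F V L₀ L₁
  have nat : ∀ i : 𝟙_ E ⟶ 𝟙_ E ⨿ 𝟙_ E, lift (toUnit U ≫ i) (𝟙 U) ≫ (𝟙_ E ⨿ 𝟙_ E) ◁ u =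
      u ≫ lift (toUnit V ≫ i) (𝟙 V) := by
    intro i
    simp [← Category.assoc]
  obtain ⟨γ, hγ₁, hγ₂⟩ := tensor_pushout_desc F (coprod.desc I.zero I.one ▷ U)
    ((𝟙_ E ⨿ 𝟙_ E) ◁ u) M δ (by
      apply endpoints_hom_ext
      · rw [← Category.assoc, ← Category.assoc, ← MonoidalCategory.whiskerLeft_comp,
          ← MonoidalCategory.whiskerLeft_comp, ← in₀_eq, nat, MonoidalCategory.whiskerLeft_comp,
          Category.assoc, hδ₀, h₀]
      · rw [← Category.assoc, ← Category.assoc, ← MonoidalCategory.whiskerLeft_comp,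
          ← MonoidalCategory.whiskerLeft_comp, ← in₁_eq, nat, MonoidalCategory.whiskerLeft_comp,
          Category.assoc, hδ₁, h₁])
  exact ⟨γ, hγ₁, by rw [hγ₂, hδ₀], by rw [hγ₂, hδ₁]⟩

theorem boundary_hom_ext (I : IntervalObject E) (F : E) {U V Z : E} (u : U ⟶ V)
    {γ δ : F ⊗ pushout (coprod.desc I.zero I.one ▷ U) ((𝟙_ E ⨿ 𝟙_ E) ◁ u) ⟶ Z}
    (h : F ◁ pushout.inl _ _ ≫ γ = F ◁ pushout.inl _ _ ≫ δ)
    (h₀ : F ◁ lift (toUnit V ≫ coprod.inl) (𝟙 V) ≫ F ◁ pushout.inr _ _ ≫ γ =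
      F ◁ lift (toUnit V ≫ coprod.inl) (𝟙 V) ≫ F ◁ pushout.inr _ _ ≫ δ)
    (h₁ : F ◁ lift (toUnit V ≫ coprod.inr) (𝟙 V) ≫ F ◁ pushout.inr _ _ ≫ γ =
      F ◁ lift (toUnit V ≫ coprod.inr) (𝟙 V) ≫ F ◁ pushout.inr _ _ ≫ δ) : γ = δ :=
  tensor_pushout_hom_ext F _ _ h (endpoints_hom_ext F V h₀ h₁)

end Cofibrations

/-! ### Homotopies, homotopy equivalences and trivial fibrations -/

section Homotopy

set_option linter.unusedSectionVars false

variable {E : Type u} [Category.{v} E] [CartesianMonoidalCategory E] [HasFiniteColimits E]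
  [HasFiniteLimits E] [MonoidalClosed E] [HasSubobjectClassifier E]
  {I : IntervalObject E} {C : MorphismProperty E}

theorem boundary_hom_ext' (I : IntervalObject E) {U V Z : E} (u : U ⟶ V)
    {γ δ : pushout (coprod.desc I.zero I.one ▷ U) ((𝟙_ E ⨿ 𝟙_ E) ◁ u) ⟶ Z}
    (h : pushout.inl _ _ ≫ γ = pushout.inl _ _ ≫ δ)
    (h₀ : lift (toUnit V ≫ coprod.inl) (𝟙 V) ≫ pushout.inr _ _ ≫ γ =
      lift (toUnit V ≫ coprod.inl) (𝟙 V) ≫ pushout.inr _ _ ≫ δ)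
    (h₁ : lift (toUnit V ≫ coprod.inr) (𝟙 V) ≫ pushout.inr _ _ ≫ γ =
      lift (toUnit V ≫ coprod.inr) (𝟙 V) ≫ pushout.inr _ _ ≫ δ) : γ = δ := by
  suffices h : snd (𝟙_ E) _ ≫ γ = snd (𝟙_ E) _ ≫ δ by
    have := congrArg (lift (toUnit _) (𝟙 _) ≫ ·) h
    simpa only [lift_snd_assoc, Category.id_comp] using this
  apply boundary_hom_ext
  · simp only [whiskerLeft_snd_assoc, h]
  · simp only [whiskerLeft_snd_assoc, h₀]
  · simp only [whiskerLeft_snd_assoc, h₁]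

/-- Filling an open box: the sides are `L₀` and `L₁`, the base (at the endpoint `1`) is `b`, and the
filler is prescribed to be `M` over a cofibrant subobject. We only record the lid. -/
theorem IsFibration.exists_lid (hC : IsCofibrationClass I C) {X Y : E} {p : X ⟶ Y}
    (hp : IsFibration I C p) {U V : E} {u : U ⟶ V} (hu : C u) (L₀ L₁ b : I.obj ⊗ V ⟶ X)
    (M : I.obj ⊗ (I.obj ⊗ U) ⟶ X) (K : I.obj ⊗ (I.obj ⊗ V) ⟶ Y)
    (hb₀ : I.in₀ V ≫ b = I.in₁ V ≫ L₀) (hb₁ : I.in₁ V ≫ b = I.in₁ V ≫ L₁)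
    (hb : I.obj ◁ u ≫ b = I.in₁ _ ≫ M)
    (hM₀ : I.obj ◁ I.in₀ U ≫ M = I.obj ◁ u ≫ L₀) (hM₁ : I.obj ◁ I.in₁ U ≫ M = I.obj ◁ u ≫ L₁)
    (hK₀ : L₀ ≫ p = I.obj ◁ I.in₀ V ≫ K) (hK₁ : L₁ ≫ p = I.obj ◁ I.in₁ V ≫ K)
    (hK : M ≫ p = I.obj ◁ I.obj ◁ u ≫ K) (hKb : b ≫ p = I.in₁ _ ≫ K) :
    ∃ l : I.obj ⊗ V ⟶ X, I.in₀ V ≫ l = I.in₀ V ≫ L₀ ∧ I.in₁ V ≫ l = I.in₀ V ≫ L₁ ∧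
      I.obj ◁ u ≫ l = I.in₀ _ ≫ M ∧ l ≫ p = I.in₀ _ ≫ K := by
  have hw : C (cylBoundary I u) := hC.leibnizProd hC.endpoints hu
  have w₀ : lift (toUnit V ≫ coprod.inl) (𝟙 V) ≫ pushout.inr _ _ ≫ cylBoundary I u = I.in₀ V := by
    rw [pushout.inr_desc, ← in₀_eq]
  have w₁ : lift (toUnit V ≫ coprod.inr) (𝟙 V) ≫ pushout.inr _ _ ≫ cylBoundary I u = I.in₁ V := by
    rw [pushout.inr_desc, ← in₁_eq]
  have w₂ : pushout.inl _ _ ≫ cylBoundary I u = I.obj ◁ u := pushout.inl_desc _ _ _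
  obtain ⟨L, hL, hL₀, hL₁⟩ := exists_boundary_desc I I.obj u L₀ L₁ M hM₀ hM₁
  -- The outer interval is the filling direction and the inner one runs from `L₀` to `L₁`. The lid
  -- is the filler at outer time `0`.
  obtain ⟨N, hN, hN₁, -⟩ := hp.fill₁ hw L b K
    (by
      apply boundary_hom_ext'
      · rw [← I.in₁_naturality_assoc, hL, reassoc_of% w₂, hb]
      · rw [← I.in₁_naturality_assoc, ← I.in₁_naturality_assoc, hL₀, reassoc_of% w₀, hb₀]
      · rw [← I.in₁_naturality_assoc, ← I.in₁_naturality_assoc, hL₁, reassoc_of% w₁, hb₁])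
    (by
      apply boundary_hom_ext
      · rw [reassoc_of% hL, hK, ← MonoidalCategory.whiskerLeft_comp_assoc, w₂]
      · rw [reassoc_of% hL₀, hK₀, ← MonoidalCategory.whiskerLeft_comp_assoc,
          ← MonoidalCategory.whiskerLeft_comp_assoc, Category.assoc, w₀]
      · rw [reassoc_of% hL₁, hK₁, ← MonoidalCategory.whiskerLeft_comp_assoc,
          ← MonoidalCategory.whiskerLeft_comp_assoc, Category.assoc, w₁])
    hKb
  refine ⟨I.in₀ _ ≫ N, ?_, ?_, ?_, ?_⟩
  · rw [← hL₀, ← hN₁, I.in₀_naturality_assoc, I.in₀_naturality_assoc, I.in₀_naturality_assoc,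
      reassoc_of% w₀]
  · rw [← hL₁, ← hN₁, I.in₀_naturality_assoc, I.in₀_naturality_assoc, I.in₀_naturality_assoc,
      reassoc_of% w₁]
  · rw [← hL, ← hN₁, I.in₀_naturality_assoc, I.in₀_naturality_assoc, reassoc_of% w₂]
  · rw [Category.assoc, hN]

theorem tensor_initial_hom_ext (F : E) {X : E} (a b : F ⊗ ⊥_ E ⟶ X) : a = b :=
  hom_ext_of_initial (snd _ _) a b

/-- Filling an open box, without a condition over a subobject. -/
theorem IsFibration.exists_lid' (hC : IsCofibrationClass I C) {X Y : E} {p : X ⟶ Y}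
    (hp : IsFibration I C p) {V : E} (L₀ L₁ b : I.obj ⊗ V ⟶ X)
    (K : I.obj ⊗ (I.obj ⊗ V) ⟶ Y)
    (hb₀ : I.in₀ V ≫ b = I.in₁ V ≫ L₀) (hb₁ : I.in₁ V ≫ b = I.in₁ V ≫ L₁)
    (hK₀ : L₀ ≫ p = I.obj ◁ I.in₀ V ≫ K) (hK₁ : L₁ ≫ p = I.obj ◁ I.in₁ V ≫ K)
    (hKb : b ≫ p = I.in₁ _ ≫ K) :
    ∃ l : I.obj ⊗ V ⟶ X, I.in₀ V ≫ l = I.in₀ V ≫ L₀ ∧ I.in₁ V ≫ l = I.in₀ V ≫ L₁ ∧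
      l ≫ p = I.in₀ _ ≫ K := by
  obtain ⟨l, h₀, h₁, -, h⟩ := hp.exists_lid hC (hC.bot V) L₀ L₁ b
    (snd _ _ ≫ snd _ _ ≫ initial.to X) K hb₀ hb₁ (tensor_initial_hom_ext _ _ _)
    (tensor_initial_hom_ext _ _ _) (tensor_initial_hom_ext _ _ _) hK₀ hK₁
    (hom_ext_of_initial (snd _ _ ≫ snd _ _) _ _) hKb
  exact ⟨l, h₀, h₁, h⟩

namespace Homotopic

theorem refl {A B : E} (f : B ⟶ A) : Homotopic I f f := ⟨snd _ _ ≫ f, by simp, by simp⟩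

theorem comp_left {A B B' : E} {f g : B ⟶ A} (h : Homotopic I f g) (k : B' ⟶ B) :
    Homotopic I (k ≫ f) (k ≫ g) := by
  obtain ⟨H, h₀, h₁⟩ := h
  refine ⟨I.obj ◁ k ≫ H, ?_, ?_⟩
  · rw [I.in₀_naturality_assoc, h₀]
  · rw [I.in₁_naturality_assoc, h₁]

theorem comp_right {A A' B : E} {f g : B ⟶ A} (h : Homotopic I f g) (k : A ⟶ A') :
    Homotopic I (f ≫ k) (g ≫ k) := by
  obtain ⟨H, h₀, h₁⟩ := h
  exact ⟨H ≫ k, by rw [reassoc_of% h₀], by rw [reassoc_of% h₁]⟩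

/-- The open box has the two homotopies as sides and the constant homotopy at `k` as base; its lid
joins `f` to `g`. With reflexivity this yields symmetry and transitivity. -/
theorem euclid (hC : IsCofibrationClass I C) {A B : E} (hA : IsFibrantObject I C A)
    {f g k : B ⟶ A} (h : Homotopic I f k) (h' : Homotopic I g k) : Homotopic I f g := by
  obtain ⟨H, rfl, h₁⟩ := h
  obtain ⟨H', rfl, h₁'⟩ := h'
  obtain ⟨l, hl₀, hl₁, -⟩ := IsFibration.exists_lid' hC hA H H' (snd _ _ ≫ k) (toUnit _)
    (by simp [h₁]) (by simp [h₁']) (toUnit_unique _ _) (toUnit_unique _ _) (toUnit_unique _ _)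
  exact ⟨l, hl₀, hl₁⟩

theorem symm (hC : IsCofibrationClass I C) {A B : E} (hA : IsFibrantObject I C A)
    {f g : B ⟶ A} (h : Homotopic I f g) : Homotopic I g f :=
  euclid hC hA (refl g) h

theorem trans (hC : IsCofibrationClass I C) {A B : E} (hA : IsFibrantObject I C A)
    {f g k : B ⟶ A} (h : Homotopic I f g) (h' : Homotopic I g k) : Homotopic I f k :=
  euclid hC hA h (symm hC hA h')

end Homotopic

/-- Cancellation of a homotopy equivalence on the right. -/
theorem IsHomotopyEquivalence.of_comp_right (hC : IsCofibrationClass I C) {X Y Z : E}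
    (hY : IsFibrantObject I C Y) {f : X ⟶ Y} {g : Y ⟶ Z}
    (hg : IsHomotopyEquivalence I g) (hfg : IsHomotopyEquivalence I (f ≫ g)) :
    IsHomotopyEquivalence I f := by
  obtain ⟨v, hv, -⟩ := hg
  obtain ⟨r, hr, hr'⟩ := hfg
  -- For the other composite, `g r f ∼ g r f g v ∼ g v ∼ 1` in diagrammatic order, using `r f g ∼
  -- 1`.
  refine ⟨g ≫ r, by simpa using hr, ?_⟩
  have h₁ := (hv.symm hC hY).comp_left ((g ≫ r) ≫ f)
  have h₂ := ((hr'.comp_left g).comp_right v).trans hC hY (by simpa using hv)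
  refine Homotopic.trans hC hY (by simpa using h₁) ?_
  simpa using h₂

/-- A retraction of a homotopy equivalence is a homotopy equivalence. -/
theorem IsHomotopyEquivalence.of_retraction (hC : IsCofibrationClass I C) {X Y : E}
    (hY : IsFibrantObject I C Y) {r : X ⟶ Y} {s : Y ⟶ X} (hr : IsHomotopyEquivalence I r)
    (hs : r ≫ s = 𝟙 X) : IsHomotopyEquivalence I s := by
  obtain ⟨g, -, hg⟩ := hr
  refine ⟨r, ?_, by rw [hs]; exact Homotopic.refl _⟩
  -- In diagrammatic order, `s r ∼ g r s r = g r ∼ 1`.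
  have h := (hg.symm hC hY).comp_right (s ≫ r)
  rw [Category.id_comp, Category.assoc, reassoc_of% hs] at h
  exact h.trans hC hY hg

/-- Trivial fibrations are homotopy equivalences. -/
theorem IsTrivialFibration.isHomotopyEquivalence (hC : IsCofibrationClass I C) {X Y : E}
    {p : X ⟶ Y} (hp : IsTrivialFibration C p) : IsHomotopyEquivalence I p := by
  have := hp _ (hC.bot Y)
  have sq : CommSq (initial.to X) (initial.to Y) p (𝟙 Y) := ⟨initial.hom_ext _ _⟩
  have hs : sq.lift ≫ p = 𝟙 Y := sq.fac_right
  generalize sq.lift = s at hs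
  refine ⟨s, ?_, by rw [hs]; exact Homotopic.refl _⟩
  have hw : C (coprod.desc I.zero I.one ▷ X) :=
    hC.dominance.pullback _ _ _ _ (isPullback_whiskerRight_fst _ X) hC.endpoints
  -- Lifting against `(1 + 1) × X → I × X` over the constant homotopy at `p` joins `p ≫ s` to the
  -- identity, since both have the same image under `p`.
  have := hp _ hw
  obtain ⟨γ, hγ₀, hγ₁⟩ := endpoints_desc (𝟙_ E) X (snd _ _ ≫ p ≫ s) (snd _ _)
  have hγ₀' := congrArg (lift (toUnit _) (𝟙 _) ≫ ·) hγ₀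
  have hγ₁' := congrArg (lift (toUnit _) (𝟙 _) ≫ ·) hγ₁
  have e : ∀ i : 𝟙_ E ⟶ 𝟙_ E ⨿ 𝟙_ E, lift (toUnit X) (𝟙 X) ≫ 𝟙_ E ◁ lift (toUnit X ≫ i) (𝟙 X) =
      lift (toUnit X ≫ i) (𝟙 X) ≫ lift (toUnit _) (𝟙 _) := by
    intro i
    apply CartesianMonoidalCategory.hom_ext
    · exact toUnit_unique _ _
    · simp
  rw [← Category.assoc, e, Category.assoc, lift_snd_assoc, Category.id_comp] at hγ₀'
  rw [← Category.assoc, e, Category.assoc, lift_snd] at hγ₁'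
  have sq : CommSq (lift (toUnit _) (𝟙 _) ≫ γ) (coprod.desc I.zero I.one ▷ X) p
      (snd _ _ ≫ p) := by
    constructor
    suffices h : γ ≫ p = snd _ _ ≫ snd _ _ ≫ p by
      rw [Category.assoc, h, lift_snd_assoc, Category.id_comp, whiskerRight_snd_assoc]
    apply endpoints_hom_ext
    · rw [reassoc_of% hγ₀, hs, Category.comp_id, whiskerLeft_snd_assoc, lift_snd_assoc,
        Category.id_comp]
    · rw [reassoc_of% hγ₁, whiskerLeft_snd_assoc, lift_snd_assoc, Category.id_comp]
  refine ⟨sq.lift, ?_, ?_⟩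
  · change I.in₀ X ≫ _ = _
    rw [in₀_eq, Category.assoc, sq.fac_left, hγ₀']
  · change I.in₁ X ≫ _ = _
    rw [in₁_eq, Category.assoc, sq.fac_left, hγ₁']

/-- A fibration between fibrant objects which is a homotopy equivalence is a trivial fibration. -/
theorem IsFibration.isTrivialFibration (hC : IsCofibrationClass I C) {X Y : E} {p : X ⟶ Y}
    (hp : IsFibration I C p) (hX : IsFibrantObject I C X) (h : IsHomotopyEquivalence I p) :
    IsTrivialFibration C p := by
  obtain ⟨g, hg, H, hH₀, hH₁⟩ := h
  -- Lifting the homotopy `g ≫ p ∼ 1` from `g` turns the homotopy section into a strict section `s`.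
  obtain ⟨G, hG, -, hG₀⟩ := hp.fill₀ (hC.bot Y) (snd _ _ ≫ initial.to X) g H
    (initial.hom_ext _ _) (tensor_initial_hom_ext _ _ _) hH₀.symm
  obtain ⟨s, hs⟩ : ∃ s, I.in₁ Y ≫ G = s := ⟨_, rfl⟩
  have hsp : s ≫ p = 𝟙 Y := by rw [← hs, Category.assoc, hG, hH₁]
  obtain ⟨K, hK₀, hK₁⟩ : Homotopic I (𝟙 X) (p ≫ s) :=
    (hg.symm hC hX).trans hC hX (Homotopic.comp_left ⟨G, hG₀, hs⟩ p)
  -- `K` need not be vertical. Composing it with the reverse of `K ≫ p ≫ s`, which has the same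
  -- projection to `Y`, gives a homotopy `l` from `1` to `p ≫ s` that is constant over `Y`.
  obtain ⟨l, hl₀, hl₁, hl⟩ := hp.exists_lid' hC K (K ≫ p ≫ s) (snd _ _ ≫ p ≫ s)
    (I.obj ◁ snd _ _ ≫ K ≫ p)
    (by simp [hK₁])
    (by rw [reassoc_of% hK₁, reassoc_of% hsp]; simp)
    (by rw [← MonoidalCategory.whiskerLeft_comp_assoc]; simp)
    (by rw [← MonoidalCategory.whiskerLeft_comp_assoc]; simp [hsp])
    (by rw [I.in₁_naturality_assoc, reassoc_of% hK₁, hsp]; simp [hsp])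
  rw [hK₀] at hl₀
  rw [reassoc_of% hK₀] at hl₁
  rw [I.in₀_naturality_assoc, reassoc_of% hK₀] at hl
  intro U V u hu
  refine ⟨fun {a b} sq => ?_⟩
  -- `b ≫ s` fills the lower triangle strictly and the upper one up to the vertical homotopy `l`;
  -- extending that homotopy back to time `0` corrects it.
  obtain ⟨N, hN, hNu, hN₁⟩ := hp.fill₁ hu (I.obj ◁ a ≫ l) (b ≫ s) (snd _ _ ≫ b)
    (by rw [I.in₁_naturality_assoc, hl₁, reassoc_of% sq.w])
    (by rw [Category.assoc, hl]; simp [sq.w])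
    (by simp [hsp])
  exact ⟨⟨⟨I.in₀ V ≫ N,
    by rw [← I.in₀_naturality_assoc, hNu, I.in₀_naturality_assoc, hl₀, Category.comp_id],
    by rw [Category.assoc, hN]; simp⟩⟩⟩

/-- A cofibration between fibrant objects which is a homotopy equivalence has the left lifting
property against all fibrations. -/
theorem IsFibration.hasLiftingProperty (hC : IsCofibrationClass I C) {U V : E} {u : U ⟶ V}
    (hu : C u) (hU : IsFibrantObject I C U) (hV : IsFibrantObject I C V)
    (h : IsHomotopyEquivalence I u) {X Y : E} {p : X ⟶ Y} (hp : IsFibration I C p) :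
    HasLiftingProperty u p := by
  obtain ⟨g, ⟨H, hH₀, hH₁⟩, hg⟩ := h
  -- Dually to the previous argument, extending `u ≫ g ∼ 1` along `u` replaces `g` by a strict
  -- retraction `r`.
  obtain ⟨G, -, hGu, hG₀⟩ := IsFibration.fill₀ hU hu H g (toUnit _) hH₀ (toUnit_unique _ _)
    (toUnit_unique _ _)
  obtain ⟨r, hr⟩ : ∃ r, I.in₁ V ≫ G = r := ⟨_, rfl⟩
  have hur : u ≫ r = 𝟙 U := by rw [← hr, ← I.in₁_naturality_assoc, hGu, hH₁]
  obtain ⟨K, hK₀, hK₁⟩ : Homotopic I (𝟙 V) (r ≫ u) :=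
    (hg.symm hC hV).trans hC hV (Homotopic.comp_right ⟨G, hG₀, hr⟩ u)
  -- The two sides agree on `U`, so the lid `l`, a homotopy from `1` to `r ≫ u`, can be taken
  -- constant on `U`: `u` is a strong deformation retract.
  obtain ⟨l, hl₀, hl₁, hlu, -⟩ := IsFibration.exists_lid hC hV hu K (I.obj ◁ (r ≫ u) ≫ K)
    (snd _ _ ≫ r ≫ u) (I.obj ◁ (snd _ _ ≫ u) ≫ K) (toUnit _)
    (by simp [hK₁])
    (by rw [I.in₁_naturality_assoc, hK₁]; simp [reassoc_of% hur])
    (by rw [I.in₁_naturality_assoc, hK₁]; simp [reassoc_of% hur])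
    (by rw [← MonoidalCategory.whiskerLeft_comp_assoc]; simp)
    (by rw [← MonoidalCategory.whiskerLeft_comp_assoc, ← MonoidalCategory.whiskerLeft_comp_assoc,
          reassoc_of% hur]; simp)
    (toUnit_unique _ _) (toUnit_unique _ _) (toUnit_unique _ _) (toUnit_unique _ _)
  rw [hK₀] at hl₀
  rw [I.in₀_naturality_assoc, hK₀, Category.assoc, Category.comp_id] at hl₁
  rw [I.in₀_naturality_assoc, hK₀, Category.comp_id] at hlu
  refine ⟨fun {a b} sq => ?_⟩
  -- `r ≫ a` lies over `r ≫ u ≫ b`; transporting it back along `l ≫ b` puts it over `b`, without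
  -- changing it on `U`.
  obtain ⟨N, hN, hNu, hN₁⟩ := hp.fill₁ hu (snd _ _ ≫ a) (r ≫ a) (l ≫ b)
    (by simp [reassoc_of% hur])
    (by rw [reassoc_of% hlu, Category.assoc, sq.w])
    (by rw [reassoc_of% hl₁, Category.assoc, sq.w])
  exact ⟨⟨⟨I.in₀ V ≫ N,
    by rw [← I.in₀_naturality_assoc, hNu]; simp,
    by rw [Category.assoc, hN, reassoc_of% hl₀]⟩⟩⟩

end Homotopy

/-! ### The Frobenius property and dependent products -/

section Frobenius

set_option linter.unusedSectionVars false

variable {E : Type u} [Category.{v} E] [CartesianMonoidalCategory E] [HasFiniteColimits E]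
  [HasFiniteLimits E] [MonoidalClosed E] [HasSubobjectClassifier E]
  {I : IntervalObject E} {C : MorphismProperty E}

theorem IsFibration.of_isPullback {X Y X' Y' : E} {p : X ⟶ Y} {p' : X' ⟶ Y'} {a : X' ⟶ X}
    {b : Y' ⟶ Y} (hp : IsFibration I C p) (sq : IsPullback a p' p b) : IsFibration I C p' :=
  fun u hu =>
    have := (hp u hu).1
    have := (hp u hu).2
    ⟨sq.hasLiftingProperty _, sq.hasLiftingProperty _⟩

theorem IsFibration.comp {X Y Z : E} {p : X ⟶ Y} {q : Y ⟶ Z} (hp : IsFibration I C p)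
    (hq : IsFibration I C q) : IsFibration I C (p ≫ q) := fun u hu => by
  obtain ⟨_, _⟩ := hp u hu
  obtain ⟨_, _⟩ := hq u hu
  exact ⟨inferInstance, inferInstance⟩

theorem IsFibration.of_isIso {X Y : E} (p : X ⟶ Y) [IsIso p] : IsFibration I C p := fun _ _ =>
  ⟨inferInstance, inferInstance⟩

theorem IsFibrantObject.of_isFibration {X Y : E} {p : X ⟶ Y} (hp : IsFibration I C p)
    (hY : IsFibrantObject I C Y) : IsFibrantObject I C X := by
  have h : IsFibration I C (p ≫ toUnit Y) := hp.comp hY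
  rwa [comp_toUnit] at h

/-- Let `j` be a cofibration whose codomain contracts into its domain, by a contraction which
preserves the domain. Then pullbacks of `j` along fibrations lift against fibrations. -/
theorem hasLiftingProperty_of_contraction (hC : IsCofibrationClass I C) {S T S' W : E}
    {j : S ⟶ T} {j' : S' ⟶ W} {s : S' ⟶ S} {q : W ⟶ T} (hj : C j) (hq : IsFibration I C q)
    (sq : IsPullback j' s q j) (c : I.obj ⊗ T ⟶ T) (d : T ⟶ S) (c' : I.obj ⊗ S ⟶ S)
    (hc₁ : I.in₁ T ≫ c = 𝟙 T) (hc₀ : I.in₀ T ≫ c = d ≫ j) (hc' : I.obj ◁ j ≫ c = c' ≫ j)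
    {X Y : E} {p : X ⟶ Y} (hp : IsFibration I C p) : HasLiftingProperty j' p := by
  have hj' : C j' := hC.dominance.pullback _ _ _ _ sq hj
  have := hC.dominance.mono _ hj'
  -- The fibration `q` lifts the contraction of `T` to a homotopy `G` on `W` ending at the identity.
  -- Because `j'` is a pullback of `j`, `G` starts inside `S'` (by `g`) and preserves `S'` (by
  -- `G'`).
  obtain ⟨G, hG, -, hG₁⟩ := hq.fill₁ (hC.bot W) (snd _ _ ≫ initial.to W) (𝟙 W) (I.obj ◁ q ≫ c)
    (initial.hom_ext _ _) (tensor_initial_hom_ext _ _ _)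
    (by rw [I.in₁_naturality_assoc, hc₁, Category.comp_id, Category.id_comp])
  obtain ⟨g, hg⟩ : ∃ g, g ≫ j' = I.in₀ W ≫ G :=
    ⟨sq.lift (I.in₀ W ≫ G) (q ≫ d)
      (by rw [Category.assoc, hG, I.in₀_naturality_assoc, hc₀, Category.assoc]), sq.lift_fst _ _ _⟩
  obtain ⟨G', hG'⟩ : ∃ G', G' ≫ j' = I.obj ◁ j' ≫ G :=
    ⟨sq.lift (I.obj ◁ j' ≫ G) (I.obj ◁ s ≫ c')
      (by rw [Category.assoc, hG, Category.assoc, ← hc', ← MonoidalCategory.whiskerLeft_comp_assoc,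
        sq.w, MonoidalCategory.whiskerLeft_comp_assoc]), sq.lift_fst _ _ _⟩
  have h₀ : I.in₀ S' ≫ G' = j' ≫ g := by
    rw [← cancel_mono j', Category.assoc, hG', Category.assoc, hg, I.in₀_naturality_assoc]
  have h₁ : I.in₁ S' ≫ G' = 𝟙 S' := by
    rw [← cancel_mono j', Category.assoc, hG', I.in₁_naturality_assoc, hG₁, Category.comp_id,
      Category.id_comp]
  refine ⟨fun {a b} w => ?_⟩
  -- The solution is known at time `0`, where everything lies in `S'`; lifting along `G ≫ b` carries
  -- it to time `1`, where `G` is the identity.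
  obtain ⟨M, hM, hMj, -⟩ := hp.fill₀ hj' (G' ≫ a) (g ≫ a) (G ≫ b)
    (by rw [reassoc_of% h₀])
    (by rw [Category.assoc, w.w, reassoc_of% hG'])
    (by rw [Category.assoc, w.w, reassoc_of% hg])
  exact ⟨⟨⟨I.in₁ W ≫ M,
    by rw [← I.in₁_naturality_assoc, hMj, reassoc_of% h₁],
    by rw [Category.assoc, hM, reassoc_of% hG₁]⟩⟩⟩

/-- The contraction of a cylinder to its endpoint `0`. -/
def IntervalObject.contract (I : IntervalObject E) (V : E) : I.obj ⊗ (I.obj ⊗ V) ⟶ I.obj ⊗ V :=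
  lift (lift (fst _ _) (snd _ _ ≫ fst _ _) ≫ I.meet) (snd _ _ ≫ snd _ _)

theorem IntervalObject.in₁_contract (I : IntervalObject E) (V : E) :
    I.in₁ _ ≫ I.contract V = 𝟙 _ := by
  have h : lift (toUnit (I.obj ⊗ V) ≫ I.one) (fst I.obj V) ≫ I.meet = fst _ _ := by
    have := congrArg (fst I.obj V ≫ ·) I.one_meet
    simpa only [comp_lift_assoc, comp_toUnit_assoc, Category.comp_id] using this
  apply CartesianMonoidalCategory.hom_ext
  · rw [contract, Category.assoc, lift_fst, comp_lift_assoc, lift_fst, lift_snd_assoc,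
      Category.id_comp, h]
  · simp [contract]

theorem IntervalObject.in₀_contract (I : IntervalObject E) (V : E) :
    I.in₀ _ ≫ I.contract V = toUnit I.obj ▷ V ≫ I.zero ▷ V := by
  have h : lift (toUnit (I.obj ⊗ V) ≫ I.zero) (fst I.obj V) ≫ I.meet =
      fst _ _ ≫ toUnit _ ≫ I.zero := by
    have := congrArg (fst I.obj V ≫ ·) I.zero_meet
    simpa only [comp_lift_assoc, comp_toUnit_assoc, Category.comp_id] using this
  apply CartesianMonoidalCategory.hom_ext
  · rw [contract, Category.assoc, lift_fst, comp_lift_assoc, lift_fst, lift_snd_assoc,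
      Category.id_comp, h, Category.assoc, whiskerRight_fst, whiskerRight_fst_assoc]
  · simp [contract]

theorem IntervalObject.zero_contract (I : IntervalObject E) (V : E) :
    I.obj ◁ I.zero ▷ V ≫ I.contract V = snd _ _ ≫ I.zero ▷ V := by
  have h : lift (fst I.obj (𝟙_ E ⊗ V)) (toUnit _ ≫ I.zero) ≫ I.meet = toUnit _ ≫ I.zero := by
    have := congrArg (fst I.obj (𝟙_ E ⊗ V) ≫ ·) I.meet_zero
    simpa only [comp_lift_assoc, comp_toUnit_assoc, Category.comp_id] using this
  have e : snd I.obj (𝟙_ E ⊗ V) ≫ fst (𝟙_ E) V ≫ I.zero = toUnit _ ≫ I.zero := by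
    rw [← Category.assoc]
    congr 1
    exact toUnit_unique _ _
  apply CartesianMonoidalCategory.hom_ext
  · rw [contract, Category.assoc, lift_fst, comp_lift_assoc, whiskerLeft_fst,
      whiskerLeft_snd_assoc, Category.assoc, whiskerRight_fst, e, h]
  · simp [contract]

theorem IntervalObject.contract_naturality (I : IntervalObject E) {U V : E} (u : U ⟶ V) :
    I.obj ◁ I.obj ◁ u ≫ I.contract V = I.contract U ≫ I.obj ◁ u := by
  apply CartesianMonoidalCategory.hom_ext
  · rw [contract, contract, Category.assoc, Category.assoc, lift_fst, comp_lift_assoc,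
      whiskerLeft_fst, whiskerLeft_snd_assoc, whiskerLeft_fst, lift_fst]
  · simp [contract]

/-- Pullbacks of the generating trivial cofibrations along fibrations lift against fibrations. -/
theorem hasLiftingProperty_pullback_leibnizProd (hC : IsCofibrationClass I C) {U V S' W : E}
    {u : U ⟶ V} (hu : C u) {j' : S' ⟶ W} {s : S' ⟶ _} {q : W ⟶ I.obj ⊗ V}
    (hq : IsFibration I C q) (sq : IsPullback j' s q (leibnizProd I.zero u))
    {X Y : E} {p : X ⟶ Y} (hp : IsFibration I C p) : HasLiftingProperty j' p := by
  -- The contraction restricts to the open box: it acts on the cylinder over `U` and, since `i ∧ 0 =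
  -- 0`, fixes the end at `0`.
  obtain ⟨c', h₁, h₂⟩ := tensor_pushout_desc I.obj (I.zero ▷ U) (𝟙_ E ◁ u)
    (I.contract U ≫ pushout.inl (I.zero ▷ U) (𝟙_ E ◁ u))
    (snd _ _ ≫ pushout.inr (I.zero ▷ U) (𝟙_ E ◁ u))
    (by rw [reassoc_of% (I.zero_contract U), pushout.condition, whiskerLeft_snd_assoc])
  refine hasLiftingProperty_of_contraction hC (hC.leibnizProd hC.zero hu) hq sq (I.contract V)
    (toUnit I.obj ▷ V ≫ pushout.inr _ _) c' (I.in₁_contract V) ?_ ?_ hp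
  · rw [I.in₀_contract, Category.assoc, pushout.inr_desc]
  · apply tensor_pushout_hom_ext
    · rw [reassoc_of% h₁, pushout.inl_desc, ← MonoidalCategory.whiskerLeft_comp_assoc,
        pushout.inl_desc, I.contract_naturality]
    · rw [reassoc_of% h₂, pushout.inr_desc, ← MonoidalCategory.whiskerLeft_comp_assoc,
        pushout.inr_desc, I.zero_contract]

/-- The bottom map of a square in `E` determines a structure map `α : T → A`. The square then lives
in the slice over `A` and transposes along `f^* ⊣ Π_f`. -/
theorem hasLiftingProperty_depProd_map {A B : E} (f : B ⟶ A) {X Y : Over B} (k : X ⟶ Y) {S T : E}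
    (j : S ⟶ T)
    (h : ∀ α : T ⟶ A, HasLiftingProperty
      ((Over.pullback f).map (Over.homMk j : Over.mk (j ≫ α) ⟶ Over.mk α)).left k.left) :
    HasLiftingProperty j ((depProd f).map k).left := by
  refine ⟨fun {a b} sq => ?_⟩
  let α := b ≫ ((depProd f).obj Y).hom
  let jo : Over.mk (j ≫ α) ⟶ Over.mk α := Over.homMk j
  have h' : HasLiftingProperty ((Over.pullback f).map jo) k := by
    have := h α
    refine ⟨fun {a b} w => ?_⟩
    have w' : CommSq a.left ((Over.pullback f).map jo).left k.left b.left :=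
      ⟨congrArg CommaMorphism.left w.w⟩
    refine ⟨⟨⟨Over.homMk w'.lift ?_, ?_, ?_⟩⟩⟩
    · rw [← Over.w k, ← Category.assoc, w'.fac_right, Over.w b]
    · ext
      exact w'.fac_left
    · ext
      exact w'.fac_right
  rw [(depProdAdj f).hasLiftingProperty_iff] at h'
  have ha : a ≫ ((depProd f).obj X).hom = j ≫ α := by
    rw [← Over.w ((depProd f).map k), ← Category.assoc, sq.w, Category.assoc]
  have sqo : CommSq (Over.homMk a ha : Over.mk (j ≫ α) ⟶ (depProd f).obj X) jo
      ((depProd f).map k) (Over.homMk b : Over.mk α ⟶ (depProd f).obj Y) :=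
    ⟨by ext; exact sq.w⟩
  exact ⟨⟨⟨sqo.lift.left, congrArg CommaMorphism.left sqo.fac_left,
    congrArg CommaMorphism.left sqo.fac_right⟩⟩⟩

/-- Dependent products preserve trivial fibrations. -/
theorem IsTrivialFibration.depProd_map (hC : IsCofibrationClass I C) {A B : E} (f : B ⟶ A)
    {X Y : Over B} {k : X ⟶ Y} (hk : IsTrivialFibration C k.left) :
    IsTrivialFibration C ((depProd f).map k).left := fun u hu =>
  hasLiftingProperty_depProd_map f k u fun α =>
    hk _ (hC.dominance.pullback _ _ _ _
      (isPullback_overPullback f (Over.homMk u : Over.mk (u ≫ α) ⟶ Over.mk α)) hu)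

/-- Dependent products along fibrations preserve fibrations. -/
theorem IsFibration.depProd_map (hC : IsCofibrationClass I C) {A B : E} {f : B ⟶ A}
    (hf : IsFibration I C f) {X Y : Over B} {k : X ⟶ Y} (hk : IsFibration I C k.left) :
    IsFibration I C ((depProd f).map k).left := fun {U V} u hu => by
  constructor
  · exact hasLiftingProperty_depProd_map f k _ fun α =>
      hasLiftingProperty_pullback_leibnizProd hC hu
        (hf.of_isPullback (IsPullback.of_hasPullback α f).flip)
        (isPullback_overPullback f
          (Over.homMk (leibnizProd I.zero u) : Over.mk (leibnizProd I.zero u ≫ α) ⟶ Over.mk α)) hk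
  · exact hasLiftingProperty_depProd_map f k _ fun α =>
      hasLiftingProperty_pullback_leibnizProd (I := I.swap) hC.swap hu
        (IsFibration.of_isPullback (I := I.swap) hf.swap (IsPullback.of_hasPullback α f).flip)
        (isPullback_overPullback f
          (Over.homMk (leibnizProd I.one u) : Over.mk (leibnizProd I.one u ≫ α) ⟶ Over.mk α))
        hk.swap

/-- Apply `Π_f` to the map from `X` to the terminal object of the slice; a right adjoint preserves
the latter. -/
theorem IsFibration.depProd_obj_hom (hC : IsCofibrationClass I C) {A B : E} {f : B ⟶ A}
    (hf : IsFibration I C f) {X : Over B} (hX : IsFibration I C X.hom) :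
    IsFibration I C ((depProd f).obj X).hom := by
  have h₁ : IsFibration I C ((depProd f).map (Over.homMk X.hom : X ⟶ Over.mk (𝟙 B))).left :=
    hf.depProd_map hC (k := (Over.homMk X.hom : X ⟶ Over.mk (𝟙 B))) hX
  have := (depProdAdj f).rightAdjoint_preservesLimits
  let e : (depProd f).obj (Over.mk (𝟙 B)) ≅ Over.mk (𝟙 A) :=
    (IsTerminal.isTerminalObj (depProd f) _ Over.mkIdTerminal).uniqueUpToIso Over.mkIdTerminal
  have he : e.hom.left = ((depProd f).obj (Over.mk (𝟙 B))).hom := by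
    rw [← Over.w e.hom]
    exact (Category.comp_id _).symm
  have : IsIso e.hom.left := inferInstanceAs (IsIso ((Over.forget A).map e.hom))
  have h₂ : IsFibration I C ((depProd f).obj (Over.mk (𝟙 B))).hom := by
    rw [← he]
    exact IsFibration.of_isIso _
  have h : IsFibration I C (_ ≫ _) := h₁.comp h₂
  rwa [Over.w] at h

end Frobenius

/-! ### Identity types of dependent products -/

section FunctionExtensionality

set_option linter.unusedSectionVars false

variable {E : Type u} [Category.{v} E] [CartesianMonoidalCategory E] [HasFiniteColimits E]
  [HasFiniteLimits E] [MonoidalClosed E] [HasSubobjectClassifier E]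
  {I : IntervalObject E} {C : MorphismProperty E}

/-- The square of an object of a slice. -/
noncomputable abbrev fibreSquare {B : E} (X : Over B) : Over B :=
  Over.mk (pullback.fst X.hom X.hom ≫ X.hom)

/-- The first projection. -/
noncomputable abbrev fibreSquareFst {B : E} (X : Over B) : fibreSquare X ⟶ X :=
  Over.homMk (pullback.fst X.hom X.hom)

/-- The second projection. -/
noncomputable abbrev fibreSquareSnd {B : E} (X : Over B) : fibreSquare X ⟶ X :=
  Over.homMk (pullback.snd X.hom X.hom) pullback.condition.symm

/-- With `exists_depProd_fibreSquare_lift`, this says that the right adjoint `Π_f` sends the square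
of `X` to the square of `Π_f X`. -/
theorem depProd_fibreSquare_hom_ext {A B : E} (f : B ⟶ A) {X : Over B} {T : Over A}
    {c c' : T ⟶ (depProd f).obj (fibreSquare X)}
    (h₁ : c ≫ (depProd f).map (fibreSquareFst X) = c' ≫ (depProd f).map (fibreSquareFst X))
    (h₂ : c ≫ (depProd f).map (fibreSquareSnd X) = c' ≫ (depProd f).map (fibreSquareSnd X)) :
    c = c' := by
  apply ((depProdAdj f).homEquiv _ _).symm.injective
  ext
  apply pullback.hom_ext
  · have := congrArg ((depProdAdj f).homEquiv _ _).symm h₁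
    rw [Adjunction.homEquiv_naturality_right_symm,
      Adjunction.homEquiv_naturality_right_symm] at this
    exact congrArg CommaMorphism.left this
  · have := congrArg ((depProdAdj f).homEquiv _ _).symm h₂
    rw [Adjunction.homEquiv_naturality_right_symm,
      Adjunction.homEquiv_naturality_right_symm] at this
    exact congrArg CommaMorphism.left this

theorem exists_depProd_fibreSquare_lift {A B : E} (f : B ⟶ A) {X : Over B} {T : Over A}
    (a b : T ⟶ (depProd f).obj X) : ∃ c : T ⟶ (depProd f).obj (fibreSquare X),
      c ≫ (depProd f).map (fibreSquareFst X) = a ∧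
      c ≫ (depProd f).map (fibreSquareSnd X) = b := by
  let a' := ((depProdAdj f).homEquiv _ _).symm a
  let b' := ((depProdAdj f).homEquiv _ _).symm b
  let c' : (Over.pullback f).obj T ⟶ fibreSquare X :=
    Over.homMk (pullback.lift a'.left b'.left ((Over.w a').trans (Over.w b').symm))
      (by
        change _ ≫ pullback.fst _ _ ≫ _ = _
        rw [pullback.lift_fst_assoc, Over.w a'])
  refine ⟨(depProdAdj f).homEquiv _ _ c', ?_, ?_⟩
  · rw [← Adjunction.homEquiv_naturality_right, ← Equiv.eq_symm_apply]
    ext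
    exact pullback.lift_fst _ _ _
  · rw [← Adjunction.homEquiv_naturality_right, ← Equiv.eq_symm_apply]
    ext
    exact pullback.lift_snd _ _ _

namespace IdentityType

variable {B : E} {X : Over B}

/-- The endpoints of a path. -/
noncomputable abbrev ends (P : IdentityType I C X) : P.path ⟶ fibreSquare X :=
  Over.homMk (pullback.lift P.src.left P.tgt.left ((Over.w P.src).trans (Over.w P.tgt).symm))
    (by
      change _ ≫ pullback.fst _ _ ≫ _ = _
      rw [pullback.lift_fst_assoc, Over.w P.src])

theorem ends_fst (P : IdentityType I C X) : P.ends ≫ fibreSquareFst X = P.src := by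
  ext
  exact pullback.lift_fst _ _ _

theorem ends_snd (P : IdentityType I C X) : P.ends ≫ fibreSquareSnd X = P.tgt := by
  ext
  exact pullback.lift_snd _ _ _

/-- The source is the endpoint fibration followed by a projection, which is a base change of `X →
B`. -/
theorem isFibration_src (P : IdentityType I C X) (hX : IsFibration I C X.hom) :
    IsFibration I C P.src.left := by
  have h : IsFibration I C (_ ≫ pullback.fst X.hom X.hom) :=
    IsFibration.comp P.fibration (hX.of_isPullback (IsPullback.of_hasPullback X.hom X.hom).flip)
  rwa [pullback.lift_fst] at h

theorem isHomotopyEquivalence_src (P : IdentityType I C X) (hC : IsCofibrationClass I C)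
    (hP : IsFibrantObject I C P.path.left) : IsHomotopyEquivalence I P.src.left :=
  P.homotopyEquivalence.of_retraction hC hP (congrArg CommaMorphism.left P.refl_src)

end IdentityType

/-- Path induction: `h` is a lift of `r'` against the fibration `Π_f(s, t)`, with `Π_f(r)` on top
and the endpoints `(s', t')` below. -/
theorem exists_isHapply (hC : IsCofibrationClass I C) {A B : E} {f : B ⟶ A}
    (hA : IsFibrantObject I C A) (hf : IsFibration I C f) {X : Over B}
    (hX : IsFibration I C X.hom) (P : IdentityType I C X)
    (Q : IdentityType I C ((depProd f).obj X)) : ∃ h, IsHapply f P Q h := by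
  have hD : IsFibration I C ((depProd f).obj X).hom := hf.depProd_obj_hom hC hX
  have hDX : IsFibrantObject I C ((depProd f).obj X).left := IsFibrantObject.of_isFibration hD hA
  have hQ : IsFibrantObject I C Q.path.left :=
    IsFibrantObject.of_isFibration (Q.isFibration_src hD) hDX
  have hends : IsFibration I C ((depProd f).map P.ends).left := hf.depProd_map hC P.fibration
  obtain ⟨c, hc₁, hc₂⟩ := exists_depProd_fibreSquare_lift f Q.src Q.tgt
  have w : (depProd f).map P.refl ≫ (depProd f).map P.ends = Q.refl ≫ c := by
    apply depProd_fibreSquare_hom_ext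
    · rw [Category.assoc, Category.assoc, hc₁, Q.refl_src, ← Functor.map_comp, P.ends_fst,
        ← Functor.map_comp, P.refl_src, CategoryTheory.Functor.map_id]
    · rw [Category.assoc, Category.assoc, hc₂, Q.refl_tgt, ← Functor.map_comp, P.ends_snd,
        ← Functor.map_comp, P.refl_tgt, CategoryTheory.Functor.map_id]
  have := hends.hasLiftingProperty hC Q.cofibration hDX hQ Q.homotopyEquivalence
  have sq : CommSq ((depProd f).map P.refl).left Q.refl.left ((depProd f).map P.ends).left c.left :=
    ⟨congrArg CommaMorphism.left w⟩
  let h : Q.path ⟶ (depProd f).obj P.path := Over.homMk sq.lift (by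
    rw [← Over.w ((depProd f).map P.ends), ← Category.assoc, sq.fac_right, Over.w c])
  have hh : h ≫ (depProd f).map P.ends = c := by
    ext
    exact sq.fac_right
  refine ⟨h, ?_, ?_, ?_⟩
  · rw [← P.ends_fst, Functor.map_comp, reassoc_of% hh, hc₁]
  · rw [← P.ends_snd, Functor.map_comp, reassoc_of% hh, hc₂]
  · ext
    exact sq.fac_left

/-- Only the source equation matters: `Π_f(s)` and `s'` are both homotopy equivalences, the first
because `s` is a trivial fibration. -/
theorem IsHapply.isHomotopyEquivalence (hC : IsCofibrationClass I C) {A B : E} {f : B ⟶ A}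
    (hA : IsFibrantObject I C A) (hf : IsFibration I C f) {X : Over B}
    (hX : IsFibration I C X.hom) {P : IdentityType I C X}
    {Q : IdentityType I C ((depProd f).obj X)} {h : Q.path ⟶ (depProd f).obj P.path}
    (hh : IsHapply f P Q h) : IsHomotopyEquivalence I h.left := by
  have hD : IsFibration I C ((depProd f).obj X).hom := hf.depProd_obj_hom hC hX
  have hDX : IsFibrantObject I C ((depProd f).obj X).left := IsFibrantObject.of_isFibration hD hA
  have hQ : IsFibrantObject I C Q.path.left :=
    IsFibrantObject.of_isFibration (Q.isFibration_src hD) hDX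
  have hP : IsFibrantObject I C P.path.left :=
    IsFibrantObject.of_isFibration (P.isFibration_src hX)
      (IsFibrantObject.of_isFibration hX (IsFibrantObject.of_isFibration hf hA))
  have hs : IsTrivialFibration C P.src.left :=
    IsFibration.isTrivialFibration hC (P.isFibration_src hX) hP (P.isHomotopyEquivalence_src hC hP)
  have hDs : IsTrivialFibration C ((depProd f).map P.src).left := hs.depProd_map hC f
  have hDP : IsFibrantObject I C ((depProd f).obj P.path).left :=
    IsFibrantObject.of_isFibration (hf.depProd_map hC (P.isFibration_src hX)) hDX
  refine hDs.isHomotopyEquivalence hC |>.of_comp_right hC hDP ?_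
  have e : h.left ≫ ((depProd f).map P.src).left = Q.src.left := congrArg CommaMorphism.left hh.src
  rw [e]
  exact Q.isHomotopyEquivalence_src hC hQ

end FunctionExtensionality

end ToposFunext

theorem mainTheorem3 {E : Type u} [Category.{v} E]
    [HasFiniteLimits E] [HasFiniteColimits E] [CartesianMonoidalCategory E] [MonoidalClosed E]
    [HasSubobjectClassifier E]
    (I : IntervalObject E) (C : MorphismProperty E) (hC : IsCofibrationClass I C) :
    (∀ {A B : E} (f : B ⟶ A), IsFibration I C f → ∀ {X Y : Over B} (k : X ⟶ Y),
      IsTrivialFibration C k.left → IsTrivialFibration C ((depProd f).map k).left) ∧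
    FunctionExtensionality I C :=
  ⟨fun f _ _ _ _ hk => hk.depProd_map hC f, fun _ hA hf _ hX P Q =>
    ⟨exists_isHapply hC hA hf hX P Q, fun _ hh => hh.isHomotopyEquivalence hC hA hf hX⟩⟩
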